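/- **Definitions.** Given integers $n_1,\dots,n_4\ge 1$ and $r=n_1+n_2+n_3+n_4$, the *4-cycle algebra* with these block sizes is the algebra $A\subseteq M_r(\mathbb C)$ of all $4\times4$ block matrices $(a_{ij})$, $a_{ij}\in M_{n_i,n_j}(\mathbb C)$, with $a_{ij}=0$ unless $i=j$ or $(i,j)\in\{(1,3),(1,4),(2,3),(2,4)\}$. These pairs are the edges of the digraph $D_4$, and the C*-algebra generated by $A$ is $C^*(A)=M_r(\mathbb C)$. Let $A,A'$ be 4-cycle algebras. A (not necessarily unital) algebra homomorphism $\phi:A\to A'$ is *star extendible* if it extends to a *-homomorphism $C^*(A)\to C^*(A')$. Its *multiplicity* is the rank of the image of a rank one projection of $A$. A star extendible embedding is *regular* if it is a direct sum (a sum of maps with mutually orthogonal supports) of star extendible embeddings $A\to A'$ of multiplicity one. A multiplicity one star extendible embedding is *rigid of type $g$*, where $g$ is one of the four symmetries of $D_4$ (the permutations of the vertices preserving $\{1,2\}$ and $\{3,4\}$), if for each edge $(i,j)$ it maps the $(i,j)$ block of $A$ into the $(g(i),g(j))$ block of $A'$. An embedding is *rigid* if it is a direct sum of rigid multiplicity one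 embeddings, and *generic* if, moreover, each of the four types occurs among the summands. A *direct system* $\mathcal A=(A_k,\alpha_k)$ consists of 4-cycle algebras $A_k$ and star extendible embeddings $\alpha_k:A_k\to A_{k+1}$, $k\in\mathbb N$. It is *generic* if all $\alpha_k$ are rigid and infinitely many of them are generic; it is *odd* if only finitely many $\alpha_k$ have even multiplicity. For a 4-cycle algebra, $H_1(A)\cong\mathbb Z$ is the first integral simplicial homology group of the 4-cycle graph with vertices $1,2,3,4$ and edges $13,14,23,24$ (the reduced digraph of $A$). A rigid embedding $\alpha$ with summands of types $g_1,\dots,g_N$ induces $H_1(\alpha)=\sum_t (g_t)_*$; equivalently, the class of an edge $e$ is sent to $\sum_f r_f[f]$, where $r_f$ is the rank of the block $f$ of $\alpha(v)$ for a rank one partial isometry $v$ in the block $e$. For a system of rigid embeddings, $H_1(\mathcal A)=\varinjlim(H_1(A_k),H_1(\alpha_k))$. A *star extendible isomorphism* between direct systems $(A_k,\alpha_k)$ and $(A'_k,\alpha'_k)$ consists of strictly increasing sequences $(n_k)$, $(m_k)$ and star extendible embeddings $\phi_k:A_{n_k}\to A'_{m_k}$, $\psi_k:A'_{m_k}\to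 A_{n_{k+1}}$ such that, for every $k$, $\psi_k\circ\phi_k$ and $\phi_{k+1}\circ\psi_k$ are the composed embeddings $A_{n_k}\to A_{n_{k+1}}$ and $A'_{m_k}\to A'_{m_{k+1}}$ of the two systems. It is a *regular isomorphism* if all the maps $\phi_k$, $\psi_k$ are regular. **Theorem 4.1.** Let $\mathcal A$ and $\mathcal A'$ be generic direct systems of 4-cycle algebras. Suppose either that both systems are odd, or that $H_1(\mathcal A)\neq0$ and $H_1(\mathcal A')\neq 0$. Then every star extendible isomorphism between $\mathcal A$ and $\mathcal A'$ is a regular isomorphism. -/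

import Mathlib

open scoped Matrix

namespace FourCycle

/-- The digraph `D₄` with loops. The vertices `0, 1, 2, 3` stand for the customary `1, 2, 3, 4`, and
the proper edges are `(1,3), (1,4), (2,3), (2,4)`. -/
def Edge (i j : Fin 4) : Prop := i = j ∨ (i < 2 ∧ 2 ≤ j)

instance (i j : Fin 4) : Decidable (Edge i j) := inferInstanceAs (Decidable (_ ∨ _))

/-- Positions of the rows and columns of a `4 × 4` block matrix with block sizes `n 0, …, n 3`. -/
abbrev Idx (n : Fin 4 → ℕ+) : Type := Σ i : Fin 4, Fin (n i)

/-- The full matrix algebra `M_r`, `r = n 0 + n 1 + n 2 + n 3`. It is the C*-algebra generated by the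
4-cycle algebra with block sizes `n`. -/
abbrev Full (n : Fin 4 → ℕ+) : Type := Matrix (Idx n) (Idx n) ℂ

/-- The 4-cycle matrix algebra with block sizes `n`: the block matrices whose `(i,j)` block vanishes
unless `(i,j)` is an edge of `D₄`. -/
def Alg (n : Fin 4 → ℕ+) : Subalgebra ℂ (Full n) where
  carrier := {M | ∀ x y, ¬ Edge x.1 y.1 → M x y = 0}
  mul_mem' := by
    intro A B hA hB x y hxy
    rw [Matrix.mul_apply]
    refine Finset.sum_eq_zero fun z _ => ?_
    by_cases h : Edge x.1 z.1
    · have h' : ¬ Edge z.1 y.1 := by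
        intro h'
        apply hxy
        unfold Edge at *
        grind
      rw [hB z y h', mul_zero]
    · rw [hA x z h, zero_mul]
  add_mem' := by
    intro A B hA hB x y hxy
    rw [Matrix.add_apply, hA x y hxy, hB x y hxy, add_zero]
  algebraMap_mem' := by
    intro c x y hxy
    rw [Matrix.algebraMap_matrix_apply, if_neg]
    rintro rfl
    exact hxy (Or.inl rfl)

/-- Complex algebra homomorphisms between 4-cycle algebras; they need not preserve units. -/
abbrev Hom (n m : Fin 4 → ℕ+) : Type := Alg n →ₙₐ[ℂ] Alg m

/-- `φ` extends to a *-homomorphism between the generated C*-algebras. -/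
def IsStarExtendible {n m : Fin 4 → ℕ+} (φ : Hom n m) : Prop :=
  ∃ Φ : Full n →⋆ₙₐ[ℂ] Full m, ∀ a : Alg n, Φ a = φ a

/-- Star extendible embeddings. -/
def IsStarEmbedding {n m : Fin 4 → ℕ+} (φ : Hom n m) : Prop :=
  Function.Injective φ ∧ IsStarExtendible φ

/-- The first position in the block `i`. -/
def Idx.first (n : Fin 4 → ℕ+) (i : Fin 4) : Idx n := ⟨i, ⟨0, (n i).pos⟩⟩

/-- A matrix unit in the `(i,j)` block of a 4-cycle algebra: a rank one partial isometry. -/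
def matUnit (n : Fin 4 → ℕ+) (i j : Fin 4) (h : Edge i j) : Alg n :=
  ⟨Matrix.single (Idx.first n i) (Idx.first n j) 1, by
    intro x y hxy
    rw [Matrix.single_apply, if_neg]
    rintro ⟨rfl, rfl⟩
    exact hxy h⟩

/-- The multiplicity of a star extendible map: the rank of the image of a minimal projection. (All
minimal projections of `M_r` are equivalent, so the choice is immaterial.) -/
noncomputable def multiplicity {n m : Fin 4 → ℕ+} (φ : Hom n m) : ℕ :=
  (φ (matUnit n 0 0 (Or.inl rfl)) : Full m).rank

/-- `φ` is the (inner) direct sum of the maps `θ t`: their supports are orthogonal and they add up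
to `φ`. -/
def IsDirectSum {n m : Fin 4 → ℕ+} {N : ℕ} (φ : Hom n m) (θ : Fin N → Hom n m) : Prop :=
  (∀ s t, s ≠ t → θ s 1 * θ t 1 = 0) ∧ ∀ a, φ a = ∑ t, θ t a

/-- Star extendible maps of multiplicity one. -/
def IsMultOne {n m : Fin 4 → ℕ+} (θ : Hom n m) : Prop :=
  IsStarExtendible θ ∧ multiplicity θ = 1

/-- Regular star extendible maps: direct sums of multiplicity one embeddings. -/
def IsRegular {n m : Fin 4 → ℕ+} (φ : Hom n m) : Prop :=
  ∃ (N : ℕ) (θ : Fin N → Hom n m), (∀ t, IsMultOne (θ t)) ∧ IsDirectSum φ θ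

/-- The group of the four symmetries of the digraph `D₄`. -/
abbrev Symm : Type := {g : Equiv.Perm (Fin 4) // ∀ i j, Edge (g i) (g j) ↔ Edge i j}

/-- `M` is supported in the `(i,j)` block. -/
def InBlock {n : Fin 4 → ℕ+} (i j : Fin 4) (M : Full n) : Prop :=
  ∀ x y, M x y ≠ 0 → x.1 = i ∧ y.1 = j

/-- Multiplicity one rigid embeddings of type `g`: the four off-diagonal block spaces are mapped to
the four distinct off-diagonal block spaces of the range algebra, in the manner of the symmetry `g`
of `D₄`. -/
def IsRigidOne {n m : Fin 4 → ℕ+} (g : Symm) (θ : Hom n m) : Prop :=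
  IsMultOne θ ∧ ∀ (i j : Fin 4) (a : Alg n), InBlock i j (a : Full n) →
    InBlock (g.1 i) (g.1 j) (θ a : Full m)

/-- Rigid embeddings: direct sums of multiplicity one rigid embeddings. -/
def IsRigid {n m : Fin 4 → ℕ+} (φ : Hom n m) : Prop :=
  ∃ (N : ℕ) (θ : Fin N → Hom n m) (g : Fin N → Symm),
    (∀ t, IsRigidOne (g t) (θ t)) ∧ IsDirectSum φ θ

/-- Generic embeddings: direct sums of multiplicity one rigid embeddings in which each of the four
types occurs. -/
def IsGenericMap {n m : Fin 4 → ℕ+} (φ : Hom n m) : Prop :=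
  ∃ (N : ℕ) (θ : Fin N → Hom n m) (g : Fin N → Symm),
    (∀ t, IsRigidOne (g t) (θ t)) ∧ IsDirectSum φ θ ∧ Function.Surjective g

/-! ### First homology -/

/-- The off-diagonal edges of `D₄`, i.e. the 1-simplices of the (reduced) complex `Δ(A)` of a 4-cycle
algebra `A`. -/
abbrev PEdge : Type := {e : Fin 4 × Fin 4 // Edge e.1 e.2 ∧ e.1 ≠ e.2}

/-- The boundary map from integral 1-chains to integral 0-chains. -/
def boundary : (PEdge → ℤ) →ₗ[ℤ] (Fin 4 → ℤ) where
  toFun c v := ∑ e : PEdge, c e * ((if e.1.2 = v then 1 else 0) - (if e.1.1 = v then 1 else 0))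
  map_add' c d := by
    ext v
    simp only [Pi.add_apply, add_mul, Finset.sum_add_distrib]
  map_smul' r c := by
    ext v
    simp only [Pi.smul_apply, smul_eq_mul, RingHom.id_apply, Finset.mul_sum, mul_assoc]

/-- The homology group `H₁(Δ(A)) ≅ ℤ` of a 4-cycle algebra `A`. As `D₄` has no three mutually adjacent
vertices there are no 2-simplices, and `H₁` is the group of 1-cycles. It does not depend on the
block sizes. -/
abbrev H1 : Submodule ℤ (PEdge → ℤ) := LinearMap.ker boundary

/-- The `(i,j)` block of `M`. -/
def block {m : Fin 4 → ℕ+} (i j : Fin 4) (M : Full m) : Full m :=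
  Matrix.of fun x y => if x.1 = i ∧ y.1 = j then M x y else 0

/-- The map on 1-chains induced by `φ`: the class of a rank one partial isometry `v` in the block
`e` is sent to `∑ r_f [f]`, where `r_f` is the rank of the block `f` of `φ v` (for a rigid map `φ`
this is the number of multiplicity one summands which carry the block `e` to the block `f`). -/
noncomputable def chainMap {n m : Fin 4 → ℕ+} (φ : Hom n m) : (PEdge → ℤ) →ₗ[ℤ] (PEdge → ℤ) where
  toFun c f := ∑ e : PEdge,
    c e * ((block f.1.1 f.1.2 (φ (matUnit n e.1.1 e.1.2 e.2.1) : Full m)).rank : ℤ)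
  map_add' c d := by
    ext v
    simp only [Pi.add_apply, add_mul, Finset.sum_add_distrib]
  map_smul' r c := by
    ext v
    simp only [Pi.smul_apply, smul_eq_mul, RingHom.id_apply, Finset.mul_sum, mul_assoc]

theorem rank_eq_trace {ι : Type*} [Fintype ι] [DecidableEq ι] (P : Matrix ι ι ℂ)
    (hP : P * P = P) : (P.rank : ℂ) = P.trace := by
  have hid : IsIdempotentElem (Matrix.toLin' P) := by
    unfold IsIdempotentElem
    rw [Module.End.mul_eq_comp, ← Matrix.toLin'_mul, hP]
  have h := (LinearMap.IsIdempotentElem.isProj_range _ hid).trace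
  rw [← Matrix.trace_toLin'_eq P, h]
  rfl

open scoped ComplexOrder in
/-- For a direct sum of rigid multiplicity one embeddings, the rank of the block `(k,l)` of the image
of a matrix unit counts the summands which carry the block `(i,j)` to the block `(k,l)`. -/
theorem rank_block {n m : Fin 4 → ℕ+} {φ : Hom n m} {N : ℕ} {θ : Fin N → Hom n m}
    {g : Fin N → Symm} (hθ : ∀ t, IsRigidOne (g t) (θ t)) (hφ : IsDirectSum φ θ)
    {i j : Fin 4} (h : Edge i j) (k l : Fin 4) :
    (block k l (φ (matUnit n i j h) : Full m)).rank
      = ∑ t, if (g t).1 i = k ∧ (g t).1 j = l then 1 else 0 := by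
  classical
  choose Φ hΦ using fun t => (hθ t).1.1
  set v : Fin N → Full m := fun t => (θ t (matUnit n i j h) : Full m) with hv
  set q : Fin N → Full m := fun t => (θ t 1 : Full m) with hq
  set T : Finset (Fin N) := Finset.univ.filter fun t => (g t).1 i = k ∧ (g t).1 j = l with hT
  set a := Idx.first n i with ha
  set b := Idx.first n j with hb
  have hvΦ : ∀ t, v t = Φ t (Matrix.single a b 1) := fun t => (hΦ t (matUnit n i j h)).symm
  have hqΦ : ∀ t, q t = Φ t 1 := fun t => (hΦ t 1).symm
  have hqs : ∀ t, (q t)ᴴ = q t := fun t => by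
    rw [hqΦ, ← Matrix.star_eq_conjTranspose, ← map_star, star_one]
  have hqq : ∀ s t, s ≠ t → q s * q t = 0 := fun s t hst => by
    have := congrArg (fun x : Alg m => (x : Full m)) (hφ.1 s t hst)
    simpa using this
  have hvq : ∀ t, v t * q t = v t := fun t => by rw [hvΦ, hqΦ, ← map_mul, mul_one]
  have hqv : ∀ t, q t * v t = v t := fun t => by rw [hvΦ, hqΦ, ← map_mul, one_mul]
  have hvsq : ∀ t, q t * (v t)ᴴ = (v t)ᴴ := fun t => by
    conv_rhs => rw [← hvq t, Matrix.conjTranspose_mul, hqs]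
  have hvqs : ∀ t, (v t)ᴴ * q t = (v t)ᴴ := fun t => by
    conv_rhs => rw [← hqv t, Matrix.conjTranspose_mul, hqs]
  have hcross1 : ∀ s t, s ≠ t → v s * (v t)ᴴ = 0 := fun s t hst => by
    rw [← hvq s, ← hvsq t, mul_assoc, ← mul_assoc (q s), hqq s t hst, zero_mul, mul_zero]
  have hcross2 : ∀ s t, s ≠ t → (v s)ᴴ * v t = 0 := fun s t hst => by
    rw [← hvqs s, ← hqv t, mul_assoc, ← mul_assoc (q s), hqq s t hst, zero_mul, mul_zero]
  have hp : ∀ t, v t * (v t)ᴴ = Φ t (Matrix.single a a 1) := fun t => by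
    rw [hvΦ, ← Matrix.star_eq_conjTranspose, ← map_star, ← map_mul,
      Matrix.star_eq_conjTranspose, Matrix.conjTranspose_single, star_one,
      Matrix.single_mul_single_same, mul_one]
  have htr : ∀ t, (v t * (v t)ᴴ).trace = 1 := fun t => by
    rw [hp]
    set o := Idx.first n 0
    have h1 : (Matrix.single a a 1 : Full n) = Matrix.single a o 1 * Matrix.single o a 1 := by
      rw [Matrix.single_mul_single_same, mul_one]
    have h2 : (Matrix.single o o 1 : Full n) = Matrix.single o a 1 * Matrix.single a o 1 := by
      rw [Matrix.single_mul_single_same, mul_one]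
    have h3 : (Φ t (Matrix.single o o 1)).rank = 1 := by
      have := (hθ t).1.2
      unfold multiplicity at this
      rw [← hΦ t] at this
      exact this
    have h4 := rank_eq_trace (Φ t (Matrix.single o o 1)) (by
      rw [← map_mul, Matrix.single_mul_single_same, mul_one])
    rw [h1, map_mul, Matrix.trace_mul_comm, ← map_mul, ← h2, ← h4, h3, Nat.cast_one]
  have hblock : block k l (φ (matUnit n i j h) : Full m) = ∑ t ∈ T, v t := by
    have hsum : (φ (matUnit n i j h) : Full m) = ∑ t, v t := by
      rw [hφ.2]
      simp [hv]
    ext x y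
    rw [hsum, hT, Finset.sum_filter, Matrix.sum_apply]
    simp only [block, Matrix.of_apply, Matrix.sum_apply]
    have hin : ∀ t, v t x y ≠ 0 → x.1 = (g t).1 i ∧ y.1 = (g t).1 j := fun t => by
      refine (hθ t).2 i j (matUnit n i j h) ?_ x y
      intro x' y' h'
      simp only [matUnit, Matrix.single_apply] at h'
      have : Idx.first n i = x' ∧ Idx.first n j = y' := by
        by_contra hc
        exact h' (if_neg hc)
      exact ⟨this.1 ▸ rfl, this.2 ▸ rfl⟩
    by_cases hxy : x.1 = k ∧ y.1 = l
    · rw [if_pos hxy]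
      refine Finset.sum_congr rfl fun t _ => ?_
      split_ifs with hg
      · rfl
      · by_contra hne
        obtain ⟨h1, h2⟩ := hin t hne
        exact hg ⟨h1 ▸ hxy.1, h2 ▸ hxy.2⟩
    · rw [if_neg hxy]
      symm
      refine Finset.sum_eq_zero fun t _ => ?_
      split_ifs with hg
      · by_contra hne
        obtain ⟨h1, h2⟩ := hin t hne
        exact hxy ⟨h1.trans hg.1, h2.trans hg.2⟩
      · rfl
  have hVV : (∑ t ∈ T, v t) * (∑ t ∈ T, v t)ᴴ = ∑ t ∈ T, v t * (v t)ᴴ := by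
    rw [Matrix.conjTranspose_sum, Finset.sum_mul_sum]
    refine Finset.sum_congr rfl fun s hs => ?_
    exact Finset.sum_eq_single_of_mem s hs fun t _ hts => hcross1 s t hts.symm
  have hidem : (∑ t ∈ T, v t * (v t)ᴴ) * (∑ t ∈ T, v t * (v t)ᴴ) = ∑ t ∈ T, v t * (v t)ᴴ := by
    rw [Finset.sum_mul_sum]
    refine Finset.sum_congr rfl fun s hs => ?_
    rw [Finset.sum_eq_single_of_mem s hs]
    · rw [hp, ← map_mul, Matrix.single_mul_single_same, mul_one]
    · intro t _ hts
      rw [mul_assoc, ← mul_assoc _ (v t), hcross2 s t hts.symm, zero_mul, mul_zero]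
  have hrank : ((∑ t ∈ T, v t).rank : ℂ) = (T.card : ℂ) := by
    rw [← Matrix.rank_self_mul_conjTranspose, hVV, rank_eq_trace _ hidem, Matrix.trace_sum,
      Finset.sum_congr rfl fun t _ => htr t]
    simp
  rw [hblock, Nat.cast_injective hrank, hT, Finset.card_filter]

/-- The action of a symmetry of `D₄` on 1-chains preserves cycles. -/
theorem symm_cycle (g : Symm) (c : PEdge → ℤ) (hc : c ∈ H1) :
    (fun f : PEdge => ∑ e : PEdge, c e * (if g.1 e.1.1 = f.1.1 ∧ g.1 e.1.2 = f.1.2 then 1 else 0))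
      ∈ H1 := by
  have key : ∀ v, boundary (fun f : PEdge => ∑ e : PEdge, c e *
      (if g.1 e.1.1 = f.1.1 ∧ g.1 e.1.2 = f.1.2 then 1 else 0)) v = boundary c (g.1.symm v) := by
    intro v
    simp only [boundary, LinearMap.coe_mk, AddHom.coe_mk, Finset.sum_mul]
    rw [Finset.sum_comm]
    refine Finset.sum_congr rfl fun e _ => ?_
    have he : Edge (g.1 e.1.1) (g.1 e.1.2) ∧ g.1 e.1.1 ≠ g.1 e.1.2 :=
      ⟨(g.2 _ _).2 e.2.1, fun h => e.2.2 (g.1.injective h)⟩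
    rw [Finset.sum_eq_single_of_mem (⟨(g.1 e.1.1, g.1 e.1.2), he⟩ : PEdge) (Finset.mem_univ _)]
    · simp [Equiv.eq_symm_apply]
    · intro f _ hf
      rw [if_neg, mul_zero, zero_mul]
      rintro ⟨h1, h2⟩
      exact hf (Subtype.ext (Prod.ext h1.symm h2.symm))
  rw [LinearMap.mem_ker] at hc ⊢
  ext v
  rw [key, hc]
  rfl

/-- Rigid embeddings induce maps on 1-chains which preserve cycles. -/
theorem chainMap_mem {n m : Fin 4 → ℕ+} {φ : Hom n m} (hφ : IsRigid φ) (c : PEdge → ℤ)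
    (hc : c ∈ H1) : chainMap φ c ∈ H1 := by
  obtain ⟨N, θ, g, hθ, hs⟩ := hφ
  have : chainMap φ c = ∑ t, fun f : PEdge => ∑ e : PEdge,
      c e * (if (g t).1 e.1.1 = f.1.1 ∧ (g t).1 e.1.2 = f.1.2 then 1 else 0) := by
    ext f
    simp only [chainMap, LinearMap.coe_mk, AddHom.coe_mk, Finset.sum_apply]
    rw [Finset.sum_comm]
    refine Finset.sum_congr rfl fun e _ => ?_
    rw [rank_block hθ hs, ← Finset.mul_sum]
    push_cast
    rfl
  rw [this]
  exact Submodule.sum_mem _ fun t _ => symm_cycle (g t) c hc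

/-- The homomorphism `H₁(φ)` induced by a rigid embedding. -/
noncomputable def H1map {n m : Fin 4 → ℕ+} (φ : Hom n m) (hφ : IsRigid φ) : H1 →ₗ[ℤ] H1 :=
  (chainMap φ).restrict (chainMap_mem hφ)

/-! ### Direct systems -/

/-- Direct systems `A₀ → A₁ → A₂ → ⋯` of 4-cycle algebras and star extendible embeddings. -/
structure System where
  size : ℕ → Fin 4 → ℕ+
  map : ∀ k, Hom (size k) (size (k + 1))
  isStarEmbedding : ∀ k, IsStarEmbedding (map k)

namespace System

/-- The composed embedding `A_k → A_l` of a system, for `k ≤ l`. -/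
noncomputable def trans (S : System) {k l : ℕ} (h : k ≤ l) : Hom (S.size k) (S.size l) :=
  Nat.leRec (motive := fun l _ => Hom (S.size k) (S.size l))
    (NonUnitalAlgHom.id ℂ (Alg (S.size k))) (fun l _ f => (S.map l).comp f) h

/-- All the embeddings of the system are rigid. -/
def IsRigid (S : System) : Prop := ∀ k, FourCycle.IsRigid (S.map k)

/-- A generic system: a system of rigid embeddings, infinitely many of which are generic. -/
def IsGeneric (S : System) : Prop :=
  S.IsRigid ∧ {k | IsGenericMap (S.map k)}.Infinite

/-- An odd system: only finitely many of the embeddings have even multiplicity. -/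
def IsOdd (S : System) : Prop := {k | Even (multiplicity (S.map k))}.Finite

/-- The homomorphism `H₁(A_k) → H₁(A_l)` induced by the rigid embeddings of a system. -/
noncomputable def H1trans (S : System) (hS : S.IsRigid) {k l : ℕ} (h : k ≤ l) : H1 →ₗ[ℤ] H1 :=
  Nat.leRec (motive := fun _ _ => H1 →ₗ[ℤ] H1)
    LinearMap.id (fun l _ f => (H1map (S.map l) (hS l)).comp f) h

/-- The limit homology group `H₁({A_k, α_k}) = lim (H₁(A_k), H₁(α_k))`. -/
abbrev H1lim (S : System) (hS : S.IsRigid) : Type :=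
  Module.DirectLimit (R := ℤ) (ι := ℕ) (fun _ => H1) (fun _ _ h => S.H1trans hS h)

end System

/-- A star extendible isomorphism between the direct systems `(A_k)` and `(B_k)`: a commuting diagram
`A_{n 0} → B_{m 0} → A_{n 1} → B_{m 1} → ⋯` of star extendible embeddings, whose composed maps
`A_{n k} → A_{n (k+1)}` and `B_{m k} → B_{m (k+1)}` are the given ones. -/
structure StarIso (S T : System) where
  n : ℕ → ℕ
  m : ℕ → ℕ
  n_strictMono : StrictMono n
  m_strictMono : StrictMono m
  toMap : ∀ k, Hom (S.size (n k)) (T.size (m k))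
  invMap : ∀ k, Hom (T.size (m k)) (S.size (n (k + 1)))
  toMap_emb : ∀ k, IsStarEmbedding (toMap k)
  invMap_emb : ∀ k, IsStarEmbedding (invMap k)
  inv_comp_to : ∀ k, (invMap k).comp (toMap k) = S.trans (n_strictMono k.lt_succ_self).le
  to_comp_inv : ∀ k, (toMap (k + 1)).comp (invMap k) = T.trans (m_strictMono k.lt_succ_self).le

/-- The isomorphism is regular: all the crossover maps are regular. -/
def StarIso.IsRegular {S T : System} (I : StarIso S T) : Prop :=
  ∀ k, FourCycle.IsRegular (I.toMap k) ∧ FourCycle.IsRegular (I.invMap k)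

end FourCycle

/-! A *-homomorphism Φ of full matrix algebras is, up to unitary equivalence, a ↦ a ⊗ 1 on its
support, and the relative commutant is 1 ⊗ M_N. The proof encodes how Φ permutes the vertices by two
symmetries (self-adjoint unitaries) U, V of this commutant: the difference of the range block
projections e₀ - e₁ acts on the support as Φ(e₀ - e₁)U, and e₂ - e₃ as Φ(e₂ - e₃)V (`SymmAt`). A
rigid embedding has such U, V, and they commute, being signed sums of the supports of its summands.
Conversely, if U and V commute, diagonalising them simultaneously splits Φ into multiplicity one
pieces that respect the blocks (`isRegular_of_commute`).

Under composition these symmetries multiply as tensors, U ⊗ U'. If a composition has the symmetries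
then so do its factors, provided sources {0,1} and sinks {2,3} are not mixed (`keepsSides_of_comp`,
`exists_symmAt_of_comp`). In a composition with commuting symmetries, UV ⊗ U'V' = VU ⊗ V'U', so the
pairs of the two factors either both commute or both anticommute (`commute_or_anticommute`).

In an isomorphism of rigid systems all consecutive compositions of crossover maps are rigid
compositions, so if one pair anticommutes, all later ones do. Anticommutation forces even
multiplicity, since U exchanges the eigenspaces of V. It also makes UV traceless. But for a rigid
map the trace of UV on a minimal projection is the integer by which the map acts on H₁, and this
trace is multiplicative; so the transition maps would vanish on H₁ and the limit would be zero.
Either hypothesis excludes this. -/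

namespace FourCycle

/-! ### Relative commutants of *-homomorphisms between matrix algebras -/

section General

set_option linter.unusedSectionVars false

variable {ι κ μ : Type*} [Fintype ι] [DecidableEq ι] [Fintype κ] [DecidableEq κ]
  [Fintype μ] [DecidableEq μ]

/-- The commutant of the range of `Φ`, cut down by the support projection `Φ 1`. -/
def relCommutant (Φ : Matrix ι ι ℂ →⋆ₙₐ[ℂ] Matrix κ κ ℂ) : NonUnitalSubalgebra ℂ (Matrix κ κ ℂ) where
  carrier := {u | (∀ a, u * Φ a = Φ a * u) ∧ u * Φ 1 = u}
  add_mem' := by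
    rintro u v ⟨hu, hu'⟩ ⟨hv, hv'⟩
    exact ⟨fun a => by rw [add_mul, mul_add, hu, hv], by rw [add_mul, hu', hv']⟩
  zero_mem' := by simp
  mul_mem' := by
    rintro u v ⟨hu, hu'⟩ ⟨hv, hv'⟩
    exact ⟨fun a => by rw [mul_assoc, hv, ← mul_assoc, hu, mul_assoc], by rw [mul_assoc, hv']⟩
  smul_mem' := by
    rintro c u ⟨hu, hu'⟩
    exact ⟨fun a => by rw [smul_mul_assoc, hu, mul_smul_comm], by rw [smul_mul_assoc, hu']⟩

variable {Φ : Matrix ι ι ℂ →⋆ₙₐ[ℂ] Matrix κ κ ℂ} {Ψ : Matrix κ κ ℂ →⋆ₙₐ[ℂ] Matrix μ μ ℂ}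

theorem relCommutant_comm {u : Matrix κ κ ℂ} (hu : u ∈ relCommutant Φ) (a : Matrix ι ι ℂ) :
    u * Φ a = Φ a * u := hu.1 a

theorem relCommutant_mul_one {u : Matrix κ κ ℂ} (hu : u ∈ relCommutant Φ) : u * Φ 1 = u := hu.2

theorem relCommutant_one_mul {u : Matrix κ κ ℂ} (hu : u ∈ relCommutant Φ) : Φ 1 * u = u := by
  rw [← hu.1, hu.2]

theorem map_one_mem_relCommutant : Φ 1 ∈ relCommutant Φ :=
  ⟨fun a => by rw [← map_mul, ← map_mul, one_mul, mul_one], by rw [← map_mul, one_mul]⟩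

theorem map_mul_mem_relCommutant {u : Matrix κ κ ℂ} {v : Matrix μ μ ℂ} (hu : u ∈ relCommutant Φ)
    (hv : v ∈ relCommutant Ψ) : Ψ u * v ∈ relCommutant (Ψ.comp Φ) := by
  refine ⟨fun a => ?_, ?_⟩
  · simp only [NonUnitalStarAlgHom.comp_apply]
    rw [mul_assoc, relCommutant_comm hv, ← mul_assoc, ← mul_assoc, ← map_mul, ← map_mul,
      relCommutant_comm hu]
  · simp only [NonUnitalStarAlgHom.comp_apply]
    rw [mul_assoc, relCommutant_comm hv, ← mul_assoc, ← map_mul, relCommutant_mul_one hu]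

/-- The element `∑ y, Φ (e y x) * z * Φ (e x y)` of the commutant of the range of `Φ`. -/
def spread (Φ : Matrix ι ι ℂ →⋆ₙₐ[ℂ] Matrix κ κ ℂ) (x : ι) (z : Matrix κ κ ℂ) : Matrix κ κ ℂ :=
  ∑ y, Φ (Matrix.single y x 1) * z * Φ (Matrix.single x y 1)

theorem map_single_mul_spread (x a b : ι) (z : Matrix κ κ ℂ) :
    Φ (Matrix.single a b 1) * spread Φ x z
      = Φ (Matrix.single a x 1) * z * Φ (Matrix.single x b 1) := by
  rw [spread, Finset.mul_sum, Finset.sum_eq_single_of_mem b (Finset.mem_univ _)]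
  · rw [← mul_assoc, ← mul_assoc, ← map_mul, Matrix.single_mul_single_same, mul_one]
  · intro y _ hy
    rw [← mul_assoc, ← mul_assoc, ← map_mul, Matrix.single_mul_single_of_ne _ _ _ _ hy.symm,
      map_zero, zero_mul, zero_mul]

theorem spread_mul_map_single (x a b : ι) (z : Matrix κ κ ℂ) :
    spread Φ x z * Φ (Matrix.single a b 1)
      = Φ (Matrix.single a x 1) * z * Φ (Matrix.single x b 1) := by
  rw [spread, Finset.sum_mul, Finset.sum_eq_single_of_mem a (Finset.mem_univ _)]
  · rw [mul_assoc, ← map_mul, Matrix.single_mul_single_same, mul_one]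
  · intro y _ hy
    rw [mul_assoc, ← map_mul, Matrix.single_mul_single_of_ne _ _ _ _ hy, map_zero, mul_zero]

theorem single_eq_mul (i x j : ι) :
    (Matrix.single i j 1 : Matrix ι ι ℂ) = Matrix.single i x 1 * Matrix.single x j 1 := by
  rw [Matrix.single_mul_single_same, mul_one]

theorem eq_sum_smul_single (a : Matrix ι ι ℂ) : a = ∑ i, ∑ j, a i j • Matrix.single i j (1 : ℂ) := by
  conv_lhs => rw [Matrix.matrix_eq_sum_single a]
  simp

theorem one_eq_sum_single : (1 : Matrix ι ι ℂ) = ∑ i, Matrix.single i i 1 := by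
  rw [← Matrix.diagonal_one, ← Matrix.sum_single_eq_diagonal]

theorem spread_mem_relCommutant (x : ι) (z : Matrix κ κ ℂ) : spread Φ x z ∈ relCommutant Φ := by
  refine ⟨fun a => ?_, ?_⟩
  · rw [eq_sum_smul_single a]
    simp only [map_sum, map_smul, Finset.mul_sum, Finset.sum_mul, mul_smul_comm, smul_mul_assoc,
      map_single_mul_spread, spread_mul_map_single]
  · rw [one_eq_sum_single, map_sum, Finset.mul_sum, spread]
    exact Finset.sum_congr rfl fun y _ => spread_mul_map_single x y y z

/-- This is the slice map of M_ι ⊗ commutant: it reads off one entry of the first tensor factor. -/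
theorem spread_map (x y : ι) (a : Matrix ι ι ℂ) :
    ∑ t, Φ (Matrix.single t x 1) * Φ a * Φ (Matrix.single y t 1) = a x y • Φ 1 := by
  rw [one_eq_sum_single, map_sum, Finset.smul_sum]
  refine Finset.sum_congr rfl fun t _ => ?_
  rw [← map_mul, ← map_mul, Matrix.single_mul_mul_single, ← map_smul, Matrix.smul_single]
  simp

/-- On the corner cut out by the minimal projection `Φ (single x x 1)`, `spread` is multiplicative;
with `star_spread` this turns projections and symmetries of the corner into projections and
symmetries of the commutant. -/
theorem spread_mul_spread (x : ι) (z w : Matrix κ κ ℂ) :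
    spread Φ x z * spread Φ x w = spread Φ x (z * Φ (Matrix.single x x 1) * w) := by
  conv_lhs => rw [spread, Finset.sum_mul]
  refine Finset.sum_congr rfl fun y _ => ?_
  rw [mul_assoc, map_single_mul_spread]
  simp only [mul_assoc]

theorem star_spread (x : ι) (z : Matrix κ κ ℂ) : star (spread Φ x z) = spread Φ x (star z) := by
  rw [spread, star_sum]
  refine Finset.sum_congr rfl fun y _ => ?_
  rw [star_mul, star_mul, ← map_star, ← map_star]
  simp [Matrix.star_eq_conjTranspose, mul_assoc]

theorem spread_map_single_self (x : ι) : spread Φ x (Φ (Matrix.single x x 1)) = Φ 1 := by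
  have := spread_map (Φ := Φ) x x (Matrix.single x x 1)
  simpa [spread] using this

/-- The map `a ⊗ u ↦ Ψ a * u` is injective on `M_κ ⊗ relCommutant Ψ`. -/
theorem entry_smul_add_eq_zero {a b : Matrix κ κ ℂ} {r s : Matrix μ μ ℂ} (hr : r ∈ relCommutant Ψ)
    (hs : s ∈ relCommutant Ψ) (h : Ψ a * r + Ψ b * s = 0) (x y : κ) :
    a x y • r + b x y • s = 0 := by
  have key : ∀ (c : Matrix κ κ ℂ) (u : Matrix μ μ ℂ), u ∈ relCommutant Ψ →
      ∑ t, Ψ (Matrix.single t x 1) * (Ψ c * u) * Ψ (Matrix.single y t 1) = c x y • u := by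
    intro c u hu
    have : ∀ t, Ψ (Matrix.single t x 1) * (Ψ c * u) * Ψ (Matrix.single y t 1)
        = Ψ (Matrix.single t x 1) * Ψ c * Ψ (Matrix.single y t 1) * u := fun t => by
      simp only [mul_assoc, relCommutant_comm hu]
    simp only [this]
    rw [← Finset.sum_mul, spread_map, smul_mul_assoc, relCommutant_one_mul hu]
  rw [← key a r hr, ← key b s hs, ← Finset.sum_add_distrib]
  refine Finset.sum_eq_zero fun t _ => ?_
  rw [← add_mul, ← mul_add, h, mul_zero, zero_mul]

/-- Matrix units carry one minimal corner to all the others, so an element of the commutant is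
determined by a single corner. -/
theorem eq_zero_of_map_single_mul {u : Matrix κ κ ℂ} (hu : u ∈ relCommutant Φ) (x : ι)
    (h : Φ (Matrix.single x x 1) * u = 0) : u = 0 := by
  rw [← relCommutant_one_mul hu, ← spread_map_single_self x, spread, Finset.sum_mul]
  refine Finset.sum_eq_zero fun y _ => ?_
  rw [mul_assoc, ← relCommutant_comm hu, mul_assoc, ← mul_assoc _ u, h, zero_mul, mul_zero]

/-- Because u commutes with the range, a ↦ tr(Φ(a)u) is a tracial functional on a full matrix
algebra, hence a multiple of the trace; a minimal projection gives the constant. -/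
theorem trace_map_mul {u : Matrix κ κ ℂ} (hu : u ∈ relCommutant Φ) (x : ι) (a : Matrix ι ι ℂ) :
    (Φ a * u).trace = a.trace * (Φ (Matrix.single x x 1) * u).trace := by
  have key : ∀ i j, (Φ (Matrix.single i j 1) * u).trace
      = if i = j then (Φ (Matrix.single x x 1) * u).trace else 0 := by
    intro i j
    rw [single_eq_mul i x j, map_mul, mul_assoc, Matrix.trace_mul_comm, mul_assoc, relCommutant_comm hu,
      ← mul_assoc, ← map_mul]
    split_ifs with hij
    · rw [hij, Matrix.single_mul_single_same, mul_one]
    · rw [Matrix.single_mul_single_of_ne _ _ _ _ (Ne.symm hij), map_zero, zero_mul, Matrix.trace_zero]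
  generalize (Φ (Matrix.single x x 1) * u).trace = T at key ⊢
  conv_lhs => rw [eq_sum_smul_single a]
  simp only [map_sum, map_smul, Finset.sum_mul, smul_mul_assoc, Matrix.trace_sum, Matrix.trace_smul,
    key, smul_eq_mul]
  simp [Matrix.trace, Finset.sum_mul]

end General

/-! ### Block projections and generation by the 4-cycle algebra -/

variable {n m l : Fin 4 → ℕ+}

/-- The projection onto the block `i`. -/
def blockProj (n : Fin 4 → ℕ+) (i : Fin 4) : Full n :=
  Matrix.diagonal fun x => if x.1 = i then 1 else 0

theorem blockProj_mul_apply (i : Fin 4) (M : Full n) (x y : Idx n) :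
    (blockProj n i * M) x y = if x.1 = i then M x y else 0 := by
  rw [blockProj, Matrix.diagonal_mul]; split_ifs <;> simp

theorem mul_blockProj_apply (i : Fin 4) (M : Full n) (x y : Idx n) :
    (M * blockProj n i) x y = if y.1 = i then M x y else 0 := by
  rw [blockProj, Matrix.mul_diagonal]; split_ifs <;> simp

theorem blockProj_mul_self (i : Fin 4) : blockProj n i * blockProj n i = blockProj n i := by
  ext x y
  rw [blockProj_mul_apply, blockProj, Matrix.diagonal_apply]
  split_ifs <;> simp_all

theorem blockProj_mul_of_ne {i j : Fin 4} (h : i ≠ j) : blockProj n i * blockProj n j = 0 := by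
  ext x y
  rw [blockProj_mul_apply, blockProj, Matrix.diagonal_apply]
  split_ifs <;> simp_all

theorem sum_blockProj : ∑ i, blockProj n i = 1 := by
  ext x y
  simp [blockProj, Matrix.sum_apply, Matrix.diagonal_apply, Matrix.one_apply]

theorem star_blockProj (i : Fin 4) : star (blockProj n i) = blockProj n i := by
  rw [Matrix.star_eq_conjTranspose, blockProj, Matrix.diagonal_conjTranspose]
  congr 1
  ext x
  by_cases h : x.1 = i <;> simp [h]

/-- The block diagonal matrices. -/
def IsBlockDiag (M : Full n) : Prop := ∀ x y, x.1 ≠ y.1 → M x y = 0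

theorem isBlockDiag_iff {M : Full n} :
    IsBlockDiag M ↔ ∀ v, blockProj n v * M = M * blockProj n v := by
  constructor
  · intro h v
    ext x y
    rw [blockProj_mul_apply, mul_blockProj_apply]
    by_cases hxy : x.1 = y.1
    · rw [hxy]
    · rw [h x y hxy]; simp
  · intro h x y hxy
    have := congrFun (congrFun (h x.1) x) y
    rwa [blockProj_mul_apply, mul_blockProj_apply, if_pos rfl, if_neg (Ne.symm hxy)] at this

theorem IsBlockDiag.comm {M : Full n} (h : IsBlockDiag M) (v : Fin 4) :
    blockProj n v * M = M * blockProj n v := isBlockDiag_iff.1 h v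

theorem IsBlockDiag.mem_alg {M : Full n} (h : IsBlockDiag M) : M ∈ Alg n :=
  fun _ _ hxy => h _ _ fun he => hxy (Or.inl he)

theorem IsBlockDiag.star {M : Full n} (h : IsBlockDiag M) : IsBlockDiag (star M) := by
  intro x y hxy
  rw [Matrix.star_apply, h y x hxy.symm, star_zero]

theorem isBlockDiag_of_mem {M : Full n} (h : M ∈ Alg n) (h' : star M ∈ Alg n) : IsBlockDiag M := by
  intro x y hxy
  by_cases he : Edge x.1 y.1
  · have he' : ¬ Edge y.1 x.1 := by unfold Edge at *; grind
    have := h' y x he'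
    rwa [Matrix.star_apply, star_eq_zero] at this
  · exact h x y he

theorem isBlockDiag_one : IsBlockDiag (1 : Full n) := fun _ _ h =>
  Matrix.one_apply_ne fun e => h (e ▸ rfl)

theorem isBlockDiag_blockProj (i : Fin 4) : IsBlockDiag (blockProj n i) := fun x y h => by
  rw [blockProj, Matrix.diagonal_apply_ne]; rintro rfl; exact h rfl

theorem single_mem_alg {x y : Idx n} (h : Edge x.1 y.1) : Matrix.single x y (1 : ℂ) ∈ Alg n := by
  intro a b hab
  rw [Matrix.single_apply, if_neg]
  rintro ⟨rfl, rfl⟩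
  exact hab h

theorem isBlockDiag_single {x y : Idx n} (h : x.1 = y.1) :
    IsBlockDiag (Matrix.single x y (1 : ℂ) : Full n) := by
  intro a b hab
  rw [Matrix.single_apply, if_neg]
  rintro ⟨rfl, rfl⟩
  exact hab h

theorem blockProj_eq_sum (i : Fin 4) :
    blockProj n i = ∑ x : Idx n, if x.1 = i then Matrix.single x x 1 else 0 := by
  rw [blockProj, ← Matrix.sum_single_eq_diagonal]
  refine Finset.sum_congr rfl fun x _ => ?_
  split_ifs <;> simp

/-- Any two vertices are joined by at most two edges, traversed in either direction, so the matrix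
units of the algebra and their adjoints generate all matrix units. -/
theorem alg_induction {p : Full n → Prop} (h0 : ∀ a ∈ Alg n, p a) (hadd : ∀ a b, p a → p b → p (a + b))
    (hmul : ∀ a b, p a → p b → p (a * b)) (hstar : ∀ a, p a → p (star a)) (a : Full n) : p a := by
  have hz : p 0 := h0 0 (zero_mem _)
  have key : ∀ x y : Idx n, ∀ c : ℂ, p (c • Matrix.single x y (1 : ℂ)) := by
    have hE : ∀ x y : Idx n, Edge x.1 y.1 → ∀ c : ℂ, p (c • Matrix.single x y (1 : ℂ)) :=
      fun x y h c => h0 _ (Subalgebra.smul_mem _ (single_mem_alg h) c)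
    have hE' : ∀ x y : Idx n, Edge y.1 x.1 → ∀ c : ℂ, p (c • Matrix.single x y (1 : ℂ)) := by
      intro x y h c
      have := hstar _ (hE y x h (star c))
      simpa [Matrix.star_eq_conjTranspose] using this
    intro x y c
    by_cases h1 : Edge x.1 y.1
    · exact hE x y h1 c
    by_cases h2 : Edge y.1 x.1
    · exact hE' x y h2 c
    -- Two sources are joined through the sink 2, two sinks through the source 0.
    by_cases hx : x.1 < 2
    · have := hmul _ _ (hE x (Idx.first n 2) (Or.inr ⟨hx, le_rfl⟩) c)
        (hE' (Idx.first n 2) y (by unfold Edge Idx.first at *; grind) 1)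
      simpa [Matrix.single_mul_single_same] using this
    · have := hmul _ _ (hE' x (Idx.first n 0) (by unfold Edge Idx.first at *; grind) c)
        (hE (Idx.first n 0) y (by unfold Edge Idx.first at *; grind) 1)
      simpa [Matrix.single_mul_single_same] using this
  rw [eq_sum_smul_single a]
  have hsum : ∀ (s : Finset (Idx n)) (f : Idx n → Full n), (∀ i, p (f i)) → p (∑ i ∈ s, f i) := by
    intro s f hf
    induction s using Finset.cons_induction with
    | empty => simpa using hz
    | cons i s hi ih => rw [Finset.sum_cons]; exact hadd _ _ (hf i) ih
  exact hsum _ _ fun i => hsum _ _ fun j => key i j _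

/-! ### *-homomorphisms preserving 4-cycle algebras, and the separation of sources from sinks -/

/-- `*`-homomorphisms between the generated C*-algebras. -/
abbrev StarHom (n m : Fin 4 → ℕ+) : Type := Full n →⋆ₙₐ[ℂ] Full m

/-- `Φ` maps the 4-cycle algebra into the 4-cycle algebra. -/
def MapsAlg (Φ : StarHom n m) : Prop := ∀ a ∈ Alg n, Φ a ∈ Alg m

/-- The block diagonal matrices are the intersection of the 4-cycle algebra with its adjoint, and Φ
preserves both. -/
theorem MapsAlg.isBlockDiag {Φ : StarHom n m} (hΦ : MapsAlg Φ) {a : Full n} (ha : IsBlockDiag a) :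
    IsBlockDiag (Φ a) := by
  refine isBlockDiag_of_mem (hΦ _ ha.mem_alg) ?_
  rw [← map_star]
  exact hΦ _ ha.star.mem_alg

/-- `Φ` maps the summands `M_{n 0} ⊕ M_{n 1}` and `M_{n 2} ⊕ M_{n 3}` of the diagonal into the
corresponding summands. -/
def KeepsSides (Φ : StarHom n m) : Prop :=
  ∀ (x : Idx n) (v : Fin 4), ¬ (x.1 < 2 ↔ v < 2) → blockProj m v * Φ (Matrix.single x x 1) = 0

theorem exists_ne_of_blockProj_mul_ne {v : Fin 4} {M : Full n} (h : blockProj n v * M ≠ 0) :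
    ∃ y z, y.1 = v ∧ M y z ≠ 0 := by
  by_contra hc
  push Not at hc
  refine h (Matrix.ext fun y z => ?_)
  rw [blockProj_mul_apply]
  split_ifs with hy
  · exact hc y z hy
  · rfl

theorem exists_ne_of_mul_blockProj_ne {v : Fin 4} {M : Full n} (h : M * blockProj n v ≠ 0) :
    ∃ y z, z.1 = v ∧ M y z ≠ 0 := by
  by_contra hc
  push Not at hc
  refine h (Matrix.ext fun y z => ?_)
  rw [mul_blockProj_apply]
  split_ifs with hy
  · exact hc y z hy
  · rfl

theorem exists_ne_of_mul_apply_ne {M N : Full n} {x y : Idx n} (h : (M * N) x y ≠ 0) :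
    ∃ z, M x z ≠ 0 ∧ N z y ≠ 0 := by
  rw [Matrix.mul_apply] at h
  obtain ⟨z, _, hz⟩ := Finset.exists_ne_zero_of_sum_ne_zero h
  exact ⟨z, left_ne_zero_of_mul hz, right_ne_zero_of_mul hz⟩

/-- A nonzero entry of Φ(e_xx) makes e_yy a multiple of e_yy Φ(e_xx) e_zy, and the projection of
block w commutes past Ψ(e_yy) to kill Ψ(Φ(e_xx)). -/
theorem blockProj_mul_map_single_eq_zero {Φ : StarHom n m} {Ψ : StarHom m l} (hΨ : MapsAlg Ψ)
    (hc : KeepsSides (Ψ.comp Φ)) {x : Idx n} {y z : Idx m}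
    (hyz : Φ (Matrix.single x x 1) y z ≠ 0) {w : Fin 4} (hw : ¬ (x.1 < 2 ↔ w < 2)) :
    blockProj l w * Ψ (Matrix.single y y 1) = 0 := by
  have h1 : (Matrix.single y y 1 : Full m) * Φ (Matrix.single x x 1) * Matrix.single z y 1
      = Φ (Matrix.single x x 1) y z • Matrix.single y y 1 := by
    rw [Matrix.single_mul_mul_single, Matrix.smul_single]; simp
  have h2 := congrArg (fun a => blockProj l w * Ψ a) h1
  simp only [map_mul, map_smul, mul_smul_comm] at h2
  rw [← mul_assoc, ← mul_assoc, (hΨ.isBlockDiag (isBlockDiag_single rfl)).comm w,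
    mul_assoc _ (blockProj l w)] at h2
  have h3 : blockProj l w * Ψ (Φ (Matrix.single x x 1)) = 0 := hc x w hw
  rw [h3, mul_zero, zero_mul] at h2
  rw [(hΨ.isBlockDiag (isBlockDiag_single rfl)).comm w]
  exact (smul_eq_zero.1 h2.symm).resolve_left hyz

/-- If a source and a sink of the first algebra both reached the same middle block, Ψ(e_yy) for y in
that block would be orthogonal to every source block and every sink block, hence zero. -/
theorem false_of_sides {Φ : StarHom n m} {Ψ : StarHom m l} (hΨ : MapsAlg Ψ)
    (hinj : ∀ y, Ψ (Matrix.single y y 1) ≠ 0) (hc : KeepsSides (Ψ.comp Φ)) {x x' : Idx n} {y z y' z' : Idx m}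
    (hyz : Φ (Matrix.single x x 1) y z ≠ 0) (hyz' : Φ (Matrix.single x' x' 1) y' z' ≠ 0)
    (hx : ¬ (x.1 < 2 ↔ x'.1 < 2)) (hy : y.1 = y'.1) : False := by
  refine hinj y ?_
  rw [← one_mul (Ψ _), ← sum_blockProj, Finset.sum_mul]
  refine Finset.sum_eq_zero fun w _ => ?_
  by_cases hw : x.1 < 2 ↔ w < 2
  · have h1 : (Matrix.single y y 1 : Full m)
        = Matrix.single y y' 1 * Matrix.single y' y' 1 * Matrix.single y' y 1 := by
      simp [Matrix.single_mul_single_same]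
    rw [h1, map_mul, map_mul, ← mul_assoc, ← mul_assoc,
      (hΨ.isBlockDiag (isBlockDiag_single hy)).comm w, mul_assoc _ (blockProj l w),
      blockProj_mul_map_single_eq_zero hΨ hc hyz' (by rw [hw] at hx; exact fun h => hx h.symm), mul_zero,
      zero_mul]
  · exact blockProj_mul_map_single_eq_zero hΨ hc hyz hw

/-- Rows of the algebra in a sink block, and columns in a source block, are supported in the
diagonal block alone. So if a source leaks into a sink block v, the image of a source-to-sink matrix
unit puts a sink into the same v, which `false_of_sides` forbids; the other case is dual. -/
theorem keepsSides_of_comp {Φ : StarHom n m} {Ψ : StarHom m l} (hΦ : MapsAlg Φ) (hΨ : MapsAlg Ψ)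
    (hinj : ∀ y, Ψ (Matrix.single y y 1) ≠ 0) (hc : KeepsSides (Ψ.comp Φ)) : KeepsSides Φ := by
  intro x v hxv
  by_contra hne
  obtain ⟨y₀, z₀, hy₀, hyz₀⟩ := exists_ne_of_blockProj_mul_ne hne
  by_cases hx : x.1 < 2
  · have hv : 2 ≤ v := by by_contra h; exact hxv ⟨fun _ => not_le.1 h, fun _ => hx⟩
    set x' := Idx.first n 2
    have hM : Φ (Matrix.single x x' 1) ∈ Alg m := hΦ _ (single_mem_alg (Or.inr ⟨hx, le_rfl⟩))
    have h1 : blockProj m v * Φ (Matrix.single x x' 1) ≠ 0 := fun h => hne (by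
      rw [single_eq_mul x x' x, map_mul, ← mul_assoc, h, zero_mul])
    obtain ⟨y, u, hy, hyu⟩ := exists_ne_of_blockProj_mul_ne h1
    have hu : u.1 = v := by
      by_contra hu
      refine hyu (hM y u ?_)
      unfold Edge; grind
    rw [single_eq_mul x x' x', map_mul] at hyu
    obtain ⟨u', -, hu'⟩ := exists_ne_of_mul_apply_ne hyu
    have hb : u'.1 = u.1 := by
      by_contra hb
      exact hu' (hΦ.isBlockDiag (isBlockDiag_single rfl) _ _ hb)
    refine false_of_sides hΨ hinj hc hyz₀ hu' ?_ (by rw [hy₀, hb, hu])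
    have : ¬ x'.1 < 2 := by simp [x', Idx.first]
    tauto
  · have hv : v < 2 := by by_contra h; exact hxv ⟨fun h' => absurd h' hx, fun h' => absurd h' h⟩
    set x' := Idx.first n 0
    have hM : Φ (Matrix.single x' x 1) ∈ Alg m :=
      hΦ _ (single_mem_alg (Or.inr ⟨by simp [x', Idx.first], not_lt.1 hx⟩))
    have h1 : Φ (Matrix.single x' x 1) * blockProj m v ≠ 0 := fun h => hne (by
      rw [(hΦ.isBlockDiag (isBlockDiag_single rfl)).comm, single_eq_mul x x' x, map_mul, mul_assoc, h, mul_zero])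
    obtain ⟨y, u, hu, hyu⟩ := exists_ne_of_mul_blockProj_ne h1
    have hy : y.1 = v := by
      by_contra hy
      refine hyu (hM y u ?_)
      unfold Edge; grind
    rw [single_eq_mul x' x' x, map_mul] at hyu
    obtain ⟨u', hu', -⟩ := exists_ne_of_mul_apply_ne hyu
    refine false_of_sides hΨ hinj hc hyz₀ hu' ?_ (by rw [hy₀, hy])
    have : x'.1 < 2 := by simp [x', Idx.first]
    tauto

/-! ### Exchange symmetries in the relative commutant -/

/-- `U` is a symmetry in the relative commutant of `Φ` which implements, on the support of `Φ`, the
exchange of the blocks `a` and `b`. -/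
structure SymmAt (Φ : StarHom n m) (a b : Fin 4) (U : Full m) : Prop where
  mem : U ∈ relCommutant Φ
  star_eq : star U = U
  sq : U * U = Φ 1
  diff : (blockProj m a - blockProj m b) * Φ 1 = Φ (blockProj n a - blockProj n b) * U
  sum : (blockProj m a + blockProj m b) * Φ 1 = Φ (blockProj n a + blockProj n b)

theorem KeepsSides.blockProj_mul_map {Φ : StarHom n m} (h : KeepsSides Φ) {i v : Fin 4}
    (hiv : ¬ (i < 2 ↔ v < 2)) : blockProj m v * Φ (blockProj n i) = 0 := by
  rw [blockProj_eq_sum i, map_sum, Finset.mul_sum]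
  refine Finset.sum_eq_zero fun x _ => ?_
  split_ifs with hx
  · exact h x v (by rwa [hx])
  · rw [map_zero, mul_zero]

theorem one_eq_sum_blockProj :
    (1 : Full n) = blockProj n 0 + blockProj n 1 + blockProj n 2 + blockProj n 3 := by
  rw [← sum_blockProj, Fin.sum_univ_four]

theorem KeepsSides.sum_zero_one {Φ : StarHom n m} (h : KeepsSides Φ) :
    (blockProj m 0 + blockProj m 1) * Φ 1 = Φ (blockProj n 0 + blockProj n 1) := by
  have e : blockProj m 0 + blockProj m 1 = 1 - blockProj m 2 - blockProj m 3 := by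
    rw [one_eq_sum_blockProj]; abel
  have h1 : (blockProj m 0 + blockProj m 1) * Φ (blockProj n 2 + blockProj n 3) = 0 := by
    rw [map_add, add_mul, mul_add, mul_add]
    repeat rw [h.blockProj_mul_map (by decide)]
    simp
  have h2 : (blockProj m 0 + blockProj m 1) * Φ (blockProj n 0 + blockProj n 1)
      = Φ (blockProj n 0 + blockProj n 1) := by
    rw [e, map_add, sub_mul, sub_mul, one_mul, mul_add, mul_add]
    repeat rw [h.blockProj_mul_map (by decide)]
    simp
  rw [one_eq_sum_blockProj, add_assoc, map_add, mul_add, h1, h2, add_zero]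

theorem KeepsSides.sum_two_three {Φ : StarHom n m} (h : KeepsSides Φ) :
    (blockProj m 2 + blockProj m 3) * Φ 1 = Φ (blockProj n 2 + blockProj n 3) := by
  have e : blockProj m 2 + blockProj m 3 = 1 - (blockProj m 0 + blockProj m 1) := by
    rw [one_eq_sum_blockProj]; abel
  have e' : blockProj n 2 + blockProj n 3 = 1 - (blockProj n 0 + blockProj n 1) := by
    rw [one_eq_sum_blockProj]; abel
  rw [e, e', sub_mul, h.sum_zero_one, one_mul, map_sub]

theorem keepsSides_of_symmAt {Φ : StarHom n m} {U V : Full m} (hU : SymmAt Φ 0 1 U)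
    (hV : SymmAt Φ 2 3 V) : KeepsSides Φ := by
  intro x v hxv
  have key : ∀ (a b : Fin 4) (W : Full m), SymmAt Φ a b W → a ≠ b → x.1 ≠ a → x.1 ≠ b → (v = a ∨ v = b) →
      blockProj m v * Φ (Matrix.single x x 1) = 0 := by
    intro a b W hW hab hxa hxb hv
    have h1 : blockProj m v * (blockProj m a + blockProj m b) = blockProj m v := by
      rcases hv with rfl | rfl
      · rw [mul_add, blockProj_mul_self, blockProj_mul_of_ne hab, add_zero]
      · rw [mul_add, blockProj_mul_self, blockProj_mul_of_ne hab.symm, zero_add]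
    have h2 : (blockProj n a + blockProj n b) * Matrix.single x x 1 = 0 := by
      ext y z
      rw [add_mul, Matrix.add_apply, blockProj_mul_apply, blockProj_mul_apply, Matrix.single_apply]
      split_ifs <;> simp_all
    rw [← one_mul (Matrix.single x x (1 : ℂ)), map_mul, ← h1, mul_assoc, ← mul_assoc _ (Φ 1), hW.sum,
      ← map_mul, h2, map_zero, mul_zero]
  by_cases hx : x.1 < 2
  · exact key 2 3 V hV (by decide) (by rintro h; rw [h] at hx; revert hx; decide)
      (by rintro h; rw [h] at hx; revert hx; decide) (by clear key; revert hxv hx; generalize x.1 = i; revert i v; decide)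
  · exact key 0 1 U hU (by decide) (by rintro h; rw [h] at hx; revert hx; decide)
      (by rintro h; rw [h] at hx; revert hx; decide) (by clear key; revert hxv hx; generalize x.1 = i; revert i v; decide)

theorem sum_mul_blockProj {a b c : Fin 4} (hab : a ≠ b) (hc : c = a ∨ c = b) :
    (blockProj n a + blockProj n b) * blockProj n c = blockProj n c := by
  rcases hc with rfl | rfl
  · rw [add_mul, blockProj_mul_self, blockProj_mul_of_ne hab.symm, add_zero]
  · rw [add_mul, blockProj_mul_self, blockProj_mul_of_ne hab, zero_add]

theorem diff_mul_sum {a b : Fin 4} (hab : a ≠ b) :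
    (blockProj n a - blockProj n b) * (blockProj n a + blockProj n b)
      = blockProj n a - blockProj n b := by
  simp only [sub_mul, mul_add, blockProj_mul_self, blockProj_mul_of_ne hab,
    blockProj_mul_of_ne hab.symm]
  abel

theorem diff_mul_diff {a b : Fin 4} (hab : a ≠ b) :
    (blockProj n a - blockProj n b) * (blockProj n a - blockProj n b)
      = blockProj n a + blockProj n b := by
  simp only [sub_mul, mul_sub, blockProj_mul_self, blockProj_mul_of_ne hab,
    blockProj_mul_of_ne hab.symm]
  abel

theorem sum_mul_map {Φ : StarHom n m} {a b c : Fin 4} (hab : a ≠ b) (hc : c = a ∨ c = b)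
    (hsum : (blockProj m a + blockProj m b) * Φ 1 = Φ (blockProj n a + blockProj n b)) :
    (blockProj m a + blockProj m b) * Φ (blockProj n c) = Φ (blockProj n c) := by
  conv_lhs => rw [← one_mul (blockProj n c), map_mul, ← mul_assoc, hsum, ← map_mul,
    sum_mul_blockProj hab hc]

theorem blockProj_mul_single (x y : Idx n) :
    blockProj n x.1 * Matrix.single x y 1 = Matrix.single x y 1 := by
  ext a b
  rw [blockProj_mul_apply, Matrix.single_apply]
  split_ifs <;> simp_all

theorem single_mul_blockProj (x y : Idx n) :
    Matrix.single x y 1 * blockProj n y.1 = Matrix.single x y 1 := by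
  ext a b
  rw [mul_blockProj_apply, Matrix.single_apply]
  split_ifs <;> simp_all

theorem eq_of_map_blockProj_mul {Φ : StarHom n m} {u v : Full m} (hu : u ∈ relCommutant Φ)
    (hv : v ∈ relCommutant Φ) (i : Fin 4)
    (h : Φ (blockProj n i) * u = Φ (blockProj n i) * v) : u = v := by
  rw [← sub_eq_zero]
  refine eq_zero_of_map_single_mul (sub_mem hu hv) (Idx.first n i) ?_
  have := single_mul_blockProj (Idx.first n i) (Idx.first n i)
  rw [← this, map_mul, mul_assoc, mul_sub]
  change _ * (Φ (blockProj n i) * u - Φ (blockProj n i) * v) = 0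
  rw [h, sub_self, mul_zero]

/-- The difference z of the two range block projections commutes with block diagonal images, so it
restricts to a minimal corner over block c and spreads to the commutant; z² is the identity on that
corner by `hsum`. The symmetries obtained for c = a and c = b are a priori unrelated: `SymmAt`
demands that they be negatives of each other. -/
theorem exists_half_symm {Φ : StarHom n m} (hΦ : MapsAlg Φ) {a b c : Fin 4} (hab : a ≠ b)
    (hc : c = a ∨ c = b)
    (hsum : (blockProj m a + blockProj m b) * Φ 1 = Φ (blockProj n a + blockProj n b)) :
    ∃ u ∈ relCommutant Φ, star u = u ∧ u * u = Φ 1 ∧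
      (blockProj m a - blockProj m b) * Φ (blockProj n c) = Φ (blockProj n c) * u := by
  set z := blockProj m a - blockProj m b with hz
  set o := Idx.first n c with ho
  have hzc : ∀ x y : Idx n, x.1 = y.1 → z * Φ (Matrix.single x y 1) = Φ (Matrix.single x y 1) * z := by
    intro x y hxy
    have := hΦ.isBlockDiag (isBlockDiag_single hxy)
    rw [hz, sub_mul, mul_sub, this.comm, this.comm]
  refine ⟨spread Φ o z, spread_mem_relCommutant _ _, ?_, ?_, ?_⟩
  · rw [star_spread, hz, star_sub, star_blockProj, star_blockProj]
  · have h1 : (blockProj m a + blockProj m b) * Φ (Matrix.single o o 1) = Φ (Matrix.single o o 1) := by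
      rw [← blockProj_mul_single o o, map_mul, ← mul_assoc, ho, Idx.first, sum_mul_map hab hc hsum]
    rw [spread_mul_spread, mul_assoc, ← hzc _ _ rfl, ← mul_assoc, hz, diff_mul_diff hab, h1,
      spread_map_single_self]
  · rw [blockProj_eq_sum, map_sum, Finset.mul_sum, Finset.sum_mul]
    refine Finset.sum_congr rfl fun x _ => ?_
    split_ifs with hx
    · rw [map_single_mul_spread, ← hzc _ _ (by rw [hx]; rfl), mul_assoc, ← map_mul,
        Matrix.single_mul_single_same, mul_one]
    · simp

theorem SymmAt.of_half {Φ : StarHom n m} {a b : Fin 4} (hab : a ≠ b) {U : Full m}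
    (hU : U ∈ relCommutant Φ) (hs : star U = U) (hsq : U * U = Φ 1)
    (hsum : (blockProj m a + blockProj m b) * Φ 1 = Φ (blockProj n a + blockProj n b))
    (ha : (blockProj m a - blockProj m b) * Φ (blockProj n a) = Φ (blockProj n a) * U)
    (hb : (blockProj m a - blockProj m b) * Φ (blockProj n b) = - (Φ (blockProj n b) * U)) :
    SymmAt Φ a b U := by
  refine ⟨hU, hs, hsq, ?_, hsum⟩
  rw [← diff_mul_sum hab, mul_assoc, hsum, map_add, mul_add, ha, hb, map_sub, sub_mul, sub_eq_add_neg]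

theorem SymmAt.left {Φ : StarHom n m} {a b : Fin 4} (hab : a ≠ b) {U : Full m} (h : SymmAt Φ a b U) :
    (blockProj m a - blockProj m b) * Φ (blockProj n a) = Φ (blockProj n a) * U := by
  have : (blockProj n a - blockProj n b) * blockProj n a = blockProj n a := by
    rw [sub_mul, blockProj_mul_self, blockProj_mul_of_ne hab.symm, sub_zero]
  rw [← one_mul (blockProj n a), map_mul, ← mul_assoc, h.diff, mul_assoc, relCommutant_comm h.mem,
    ← mul_assoc, ← map_mul, this, ← map_mul, one_mul]

theorem SymmAt.right {Φ : StarHom n m} {a b : Fin 4} (hab : a ≠ b) {U : Full m} (h : SymmAt Φ a b U) :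
    (blockProj m a - blockProj m b) * Φ (blockProj n b) = - (Φ (blockProj n b) * U) := by
  have : (blockProj n a - blockProj n b) * blockProj n b = - blockProj n b := by
    rw [sub_mul, blockProj_mul_self, blockProj_mul_of_ne hab, zero_sub]
  rw [← one_mul (blockProj n b), map_mul, ← mul_assoc, h.diff, mul_assoc, relCommutant_comm h.mem,
    ← mul_assoc, ← map_mul, this, ← map_mul, one_mul, map_neg, neg_mul]

/-! ### Symmetries of a composition and of its factors -/

theorem SymmAt.unique {Φ : StarHom n m} {a b : Fin 4} (hab : a ≠ b) {U V : Full m}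
    (hU : SymmAt Φ a b U) (hV : SymmAt Φ a b V) : U = V :=
  eq_of_map_blockProj_mul hU.mem hV.mem a (by rw [← hU.left hab, hV.left hab])

theorem SymmAt.comp {Φ : StarHom n m} {Ψ : StarHom m l} {a b : Fin 4} {U : Full m} {V : Full l}
    (hU : SymmAt Φ a b U) (hV : SymmAt Ψ a b V) : SymmAt (Ψ.comp Φ) a b (Ψ U * V) := by
  have e : ∀ x : Full l, x * Ψ (Φ 1) = x * Ψ 1 * Ψ (Φ 1) := fun x => by
    rw [mul_assoc, ← map_mul, one_mul]
  refine ⟨map_mul_mem_relCommutant hU.mem hV.mem, ?_, ?_, ?_, ?_⟩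
  · rw [star_mul, ← map_star, hU.star_eq, hV.star_eq, relCommutant_comm hV.mem]
  · rw [mul_assoc, ← mul_assoc V, relCommutant_comm hV.mem, mul_assoc, hV.sq, ← mul_assoc, ← map_mul,
      hU.sq, ← map_mul, mul_one]
    rfl
  · simp only [NonUnitalStarAlgHom.comp_apply]
    rw [e, hV.diff, mul_assoc, relCommutant_comm hV.mem, ← mul_assoc, ← map_mul, hU.diff, map_mul,
      mul_assoc]
  · simp only [NonUnitalStarAlgHom.comp_apply]
    rw [e, hV.sum, ← map_mul, hU.sum]

/-- Over block c, the projections onto the middle blocks a and b are (1 ± u)/2, on which z acts as v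
and w. Hence the symmetry of the composition is ½(u ⊗ (v - w) + 1 ⊗ (v + w)). -/
theorem half_comp {Φ : StarHom n m} {Ψ : StarHom m l} {a b c : Fin 4} (hab : a ≠ b)
    (hc : c = a ∨ c = b) {u : Full m} {v w : Full l}
    (hsum : (blockProj m a + blockProj m b) * Φ 1 = Φ (blockProj n a + blockProj n b))
    (hu : (blockProj m a - blockProj m b) * Φ (blockProj n c) = Φ (blockProj n c) * u)
    (hvm : v ∈ relCommutant Ψ) (hwm : w ∈ relCommutant Ψ)
    (hv : (blockProj l a - blockProj l b) * Ψ (blockProj m a) = Ψ (blockProj m a) * v)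
    (hw : (blockProj l a - blockProj l b) * Ψ (blockProj m b) = Ψ (blockProj m b) * w) :
    (2 : ℂ) • ((blockProj l a - blockProj l b) * Ψ (Φ (blockProj n c)))
      = Ψ (Φ (blockProj n c)) * (Ψ u * (v - w) + Ψ (Φ 1) * (v + w)) := by
  set X := Φ (blockProj n c) with hX
  set z := blockProj l a - blockProj l b
  have hs : blockProj m a * X + blockProj m b * X = X := by
    rw [← add_mul, hX, sum_mul_map hab hc hsum]
  have hd : blockProj m a * X - blockProj m b * X = X * u := by rw [← sub_mul, hu]
  have h1 : (2 : ℂ) • (blockProj m a * X) = X + X * u := by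
    rw [← hd]; nth_rewrite 2 [← hs]; rw [two_smul]; abel
  have h2 : (2 : ℂ) • (blockProj m b * X) = X - X * u := by
    rw [← hd]; nth_rewrite 2 [← hs]; rw [two_smul]; abel
  have h3 : z * Ψ (blockProj m a * X) = Ψ (blockProj m a * X) * v := by
    rw [map_mul, ← mul_assoc, hv, mul_assoc, relCommutant_comm hvm, ← mul_assoc]
  have h4 : z * Ψ (blockProj m b * X) = Ψ (blockProj m b * X) * w := by
    rw [map_mul, ← mul_assoc, hw, mul_assoc, relCommutant_comm hwm, ← mul_assoc]
  have hX1 : Ψ X * Ψ (Φ 1) = Ψ X := by rw [hX, ← map_mul, ← map_mul, mul_one]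
  calc (2 : ℂ) • (z * Ψ X) = (2 : ℂ) • (Ψ (blockProj m a * X) * v + Ψ (blockProj m b * X) * w) := by
        rw [← h3, ← h4, ← mul_add, ← map_add, hs]
    _ = Ψ ((2 : ℂ) • (blockProj m a * X)) * v + Ψ ((2 : ℂ) • (blockProj m b * X)) * w := by
        rw [map_smul, map_smul, smul_add, smul_mul_assoc, smul_mul_assoc]
    _ = Ψ X * (Ψ u * (v - w) + Ψ (Φ 1) * (v + w)) := by
        rw [h1, h2, mul_add (Ψ X), ← mul_assoc (Ψ X) (Ψ (Φ 1)), hX1, map_add, map_sub, map_mul]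
        simp only [add_mul, sub_mul, mul_add, mul_sub, mul_assoc]
        abel

theorem exists_apply_ne {M : Full n} (h : M ≠ 0) : ∃ x y, M x y ≠ 0 := by
  by_contra hc
  push Not at hc
  exact h (Matrix.ext hc)

/-- Write u, u' for the two half symmetries of Φ and v, v' for those of Ψ. Those of the composition
are W and -W, so `half_comp` gives (u + u') ⊗ (v - v') + 1 ⊗ 2(v + v') = 0. Comparing entries makes
v + v' a multiple of v - v', and v² = v'² forces the multiple to be zero; then u + u' = 0 as well.
-/
theorem exists_symmAt_of_comp {Φ : StarHom n m} {Ψ : StarHom m l} (hΦ : MapsAlg Φ) (hΨ : MapsAlg Ψ)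
    {a b : Fin 4} (hab : a ≠ b)
    (hsΦ : (blockProj m a + blockProj m b) * Φ 1 = Φ (blockProj n a + blockProj n b))
    (hsΨ : (blockProj l a + blockProj l b) * Ψ 1 = Ψ (blockProj m a + blockProj m b))
    (hΦ1 : Φ 1 ≠ 0) (hΨ1 : Ψ 1 ≠ 0) {W : Full l} (hW : SymmAt (Ψ.comp Φ) a b W) :
    (∃ U, SymmAt Φ a b U) ∧ ∃ U, SymmAt Ψ a b U := by
  obtain ⟨u, hum, hus, husq, hu⟩ := exists_half_symm hΦ hab (Or.inl rfl) hsΦ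
  obtain ⟨u', hum', hus', husq', hu'⟩ := exists_half_symm hΦ hab (Or.inr rfl) hsΦ
  obtain ⟨v, hvm, hvs, hvsq, hv⟩ := exists_half_symm hΨ hab (Or.inl rfl) hsΨ
  obtain ⟨v', hvm', hvs', hvsq', hv'⟩ := exists_half_symm hΨ hab (Or.inr rfl) hsΨ
  have hm : ∀ x ∈ relCommutant Φ, Ψ x * (v - v') + Ψ (Φ 1) * (v + v') ∈ relCommutant (Ψ.comp Φ) :=
    fun x hx => add_mem (map_mul_mem_relCommutant hx (sub_mem hvm hvm'))
      (map_mul_mem_relCommutant map_one_mem_relCommutant (add_mem hvm hvm'))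
  have h1 : (2 : ℂ) • W = Ψ u * (v - v') + Ψ (Φ 1) * (v + v') := by
    refine eq_of_map_blockProj_mul (SMulMemClass.smul_mem _ hW.mem) (hm u hum) a ?_
    rw [mul_smul_comm, ← hW.left hab]
    exact half_comp hab (Or.inl rfl) hsΦ hu hvm hvm' hv hv'
  have h2 : (-2 : ℂ) • W = Ψ u' * (v - v') + Ψ (Φ 1) * (v + v') := by
    refine eq_of_map_blockProj_mul (SMulMemClass.smul_mem _ hW.mem) (hm u' hum') b ?_
    rw [neg_smul, mul_neg, mul_smul_comm, ← smul_neg, ← hW.right hab]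
    exact half_comp hab (Or.inr rfl) hsΦ hu' hvm hvm' hv hv'
  have h3 : Ψ (u + u') * (v - v') + Ψ (Φ 1) * ((2 : ℂ) • (v + v')) = 0 := by
    have h0 : (2 : ℂ) • W + (-2 : ℂ) • W = 0 := by rw [← add_smul]; simp
    rw [← h0, h1, h2, map_add, add_mul, two_smul, mul_add]
    abel
  have h4 := entry_smul_add_eq_zero (sub_mem hvm hvm')
    (SMulMemClass.smul_mem (2 : ℂ) (add_mem hvm hvm')) h3
  -- A nonzero entry of Φ(1) allows the tensor relation to be solved for v + v'.
  obtain ⟨x, y, hxy⟩ := exists_apply_ne hΦ1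
  obtain ⟨c, hcc⟩ : ∃ c : ℂ, v + v' = c • (v - v') := by
    refine ⟨-(u + u') x y / (2 * Φ 1 x y), ?_⟩
    have h5 := h4 x y
    rw [smul_smul, add_comm] at h5
    rw [neg_div, neg_smul, div_eq_inv_mul, mul_smul, eq_neg_of_add_eq_zero_right h5, smul_neg, neg_neg,
      smul_smul, mul_comm (Φ 1 x y), inv_mul_cancel₀ (mul_ne_zero two_ne_zero hxy), one_smul]
  have hv2 : (2 : ℂ) • v = (c + 1) • (v - v') := by rw [add_smul, ← hcc, one_smul, two_smul]; abel
  have hv2' : (2 : ℂ) • v' = (c - 1) • (v - v') := by rw [sub_smul, ← hcc, one_smul, two_smul]; abel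
  have hne : v - v' ≠ 0 := by
    intro h
    rw [h, smul_zero] at hv2
    rw [(smul_eq_zero.1 hv2).resolve_left two_ne_zero, zero_mul] at hvsq
    exact hΨ1 hvsq.symm
  have e1 : (4 : ℂ) • Ψ 1 = ((c + 1) * (c + 1)) • ((v - v') * (v - v')) := by
    rw [← smul_mul_smul_comm, ← hv2, smul_mul_smul_comm, hvsq]; norm_num
  have e2 : (4 : ℂ) • Ψ 1 = ((c - 1) * (c - 1)) • ((v - v') * (v - v')) := by
    rw [← smul_mul_smul_comm, ← hv2', smul_mul_smul_comm, hvsq']; norm_num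
  -- Both (c + 1)² and (c - 1)² times (v - v')² equal 4Ψ(1) ≠ 0.
  have hc0 : c = 0 := by
    have e3 : (4 * c) • ((v - v') * (v - v')) = 0 := by
      have : 4 * c = (c + 1) * (c + 1) - (c - 1) * (c - 1) := by ring
      rw [this, sub_smul, ← e1, ← e2, sub_self]
    rcases smul_eq_zero.1 e3 with h | h
    · simpa using h
    · rw [h, smul_zero] at e1
      exact absurd ((smul_eq_zero.1 e1).resolve_left (by norm_num)) hΨ1
  rw [hc0, zero_smul] at hcc
  have huu : u + u' = 0 := by
    ext i j
    have h5 := h4 i j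
    rw [hcc, smul_zero, smul_zero, add_zero] at h5
    exact (smul_eq_zero.1 h5).resolve_right hne
  refine ⟨⟨u, .of_half hab hum hus husq hsΦ hu ?_⟩, v, .of_half hab hvm hvs hvsq hsΨ hv ?_⟩
  · rw [hu', eq_neg_of_add_eq_zero_right huu, mul_neg]
  · rw [hv', eq_neg_of_add_eq_zero_right hcc, mul_neg]

theorem map_mul_mul_map_mul {Ψ : StarHom m l} {U V : Full m} {U' V' : Full l}
    (hU' : U' ∈ relCommutant Ψ) : (Ψ U * U') * (Ψ V * V') = Ψ (U * V) * (U' * V') := by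
  rw [mul_assoc, ← mul_assoc U', relCommutant_comm hU', map_mul]
  simp only [mul_assoc]

/-- The hypothesis says UV ⊗ U'V' = VU ⊗ V'U' with nonzero factors, so VU = c·UV and U'V' = c·V'U'
for one scalar c. Conjugation by U exchanges UV and VU, whence c² = 1. -/
theorem commute_or_anticommute {Φ : StarHom n m} {Ψ : StarHom m l} (hΦ1 : Φ 1 ≠ 0) (hΨ1 : Ψ 1 ≠ 0)
    {U V : Full m} {U' V' : Full l} (hU : SymmAt Φ 0 1 U) (hV : SymmAt Φ 2 3 V)
    (hU' : SymmAt Ψ 0 1 U') (hV' : SymmAt Ψ 2 3 V')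
    (h : (Ψ U * U') * (Ψ V * V') = (Ψ V * V') * (Ψ U * U')) :
    (U * V = V * U ∧ U' * V' = V' * U') ∨ (U * V = -(V * U) ∧ U' * V' = -(V' * U')) := by
  have h1 : Ψ (U * V) * (U' * V') + Ψ (V * U) * (-(V' * U')) = 0 := by
    rwa [mul_neg, ← sub_eq_add_neg, sub_eq_zero, ← map_mul_mul_map_mul hU'.mem,
      ← map_mul_mul_map_mul hV'.mem]
  have h2 : ∀ x y, (U * V) x y • (U' * V') = (V * U) x y • (V' * U') := fun x y => by
    have := entry_smul_add_eq_zero (mul_mem hU'.mem hV'.mem) (neg_mem (mul_mem hV'.mem hU'.mem)) h1 x y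
    rwa [smul_neg, ← sub_eq_add_neg, sub_eq_zero] at this
  have hUV : (U * V) * (V * U) = Φ 1 := by
    rw [mul_assoc, ← mul_assoc V, hV.sq, ← mul_assoc, relCommutant_mul_one hU.mem, hU.sq]
  have hVU' : (U' * V') * (V' * U') = Ψ 1 := by
    rw [mul_assoc, ← mul_assoc V', hV'.sq, ← mul_assoc, relCommutant_mul_one hU'.mem, hU'.sq]
  have hne : U * V ≠ 0 := fun h => hΦ1 (by rw [← hUV, h, zero_mul])
  have hne' : V' * U' ≠ 0 := fun h => hΨ1 (by rw [← hVU', h, mul_zero])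
  obtain ⟨x, y, hxy⟩ := exists_apply_ne hne
  obtain ⟨c, hc⟩ : ∃ c : ℂ, U' * V' = c • (V' * U') := by
    refine ⟨((U * V) x y)⁻¹ * (V * U) x y, ?_⟩
    rw [mul_smul, ← h2, smul_smul, inv_mul_cancel₀ hxy, one_smul]
  have hB : V * U = c • (U * V) := by
    ext i j
    have := h2 i j
    rw [hc, smul_smul] at this
    rw [Matrix.smul_apply, smul_eq_mul, mul_comm]
    exact (smul_left_injective ℂ hne' this).symm
  have hA : U * V = c • (V * U) := by
    have h3 := congrArg (fun M => U * M * U) hB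
    simp only [mul_smul_comm, smul_mul_assoc] at h3
    rwa [mul_assoc, mul_assoc V, hU.sq, relCommutant_mul_one hV.mem, ← mul_assoc U, hU.sq,
      relCommutant_one_mul hV.mem] at h3
  have hcc : c * c = 1 := by
    rw [hB, smul_smul] at hA
    have : (c * c - 1) • (U * V) = 0 := by rw [sub_smul, ← hA, one_smul, sub_self]
    exact sub_eq_zero.1 ((smul_eq_zero.1 this).resolve_right hne)
  rcases mul_self_eq_one_iff.1 hcc with rfl | rfl
  · left; exact ⟨by rw [hA, one_smul], by rw [hc, one_smul]⟩
  · right; exact ⟨by rw [hA, neg_one_smul], by rw [hc, neg_one_smul]⟩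

/-! ### Rank one decompositions of a projection compatible with commuting symmetries -/

section Decomposition

set_option linter.unusedSectionVars false

variable {κ : Type} [Fintype κ] [DecidableEq κ]

/-- `p` is the orthogonal sum of the rank one projections `q t`. -/
structure IsMinDecomp {ι : Type} [Fintype ι] (p : Matrix κ κ ℂ) (q : ι → Matrix κ κ ℂ) : Prop where
  star_eq : ∀ t, star (q t) = q t
  idem : ∀ t, q t * q t = q t
  rank : ∀ t, (q t).rank = 1
  orth : ∀ s t, s ≠ t → q s * q t = 0
  sum : ∑ t, q t = p

theorem IsMinDecomp.mul_left {ι : Type} [Fintype ι] {p : Matrix κ κ ℂ} {q : ι → Matrix κ κ ℂ}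
    (h : IsMinDecomp p q) (t : ι) : p * q t = q t := by
  classical
  rw [← h.sum, Finset.sum_mul, Finset.sum_eq_single_of_mem t (Finset.mem_univ _), h.idem]
  exact fun s _ hs => h.orth s t hs

theorem IsMinDecomp.mul_right {ι : Type} [Fintype ι] {p : Matrix κ κ ℂ} {q : ι → Matrix κ κ ℂ}
    (h : IsMinDecomp p q) (t : ι) : q t * p = q t := by
  classical
  rw [← h.sum, Finset.mul_sum, Finset.sum_eq_single_of_mem t (Finset.mem_univ _), h.idem]
  exact fun s _ hs => h.orth t s hs.symm

theorem IsMinDecomp.sumElim {ι ι' : Type} [Fintype ι] [Fintype ι'] {p p' : Matrix κ κ ℂ}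
    {q : ι → Matrix κ κ ℂ} {q' : ι' → Matrix κ κ ℂ} (h : IsMinDecomp p q) (h' : IsMinDecomp p' q')
    (hpp : p * p' = 0) (hpp' : p' * p = 0) : IsMinDecomp (p + p') (Sum.elim q q') := by
  refine ⟨?_, ?_, ?_, ?_, ?_⟩
  · rintro (t | t); exacts [h.star_eq t, h'.star_eq t]
  · rintro (t | t); exacts [h.idem t, h'.idem t]
  · rintro (t | t); exacts [h.rank t, h'.rank t]
  · rintro (s | s) (t | t) hst
    · exact h.orth s t fun e => hst (e ▸ rfl)
    · rw [Sum.elim_inl, Sum.elim_inr, ← h.mul_right, ← h'.mul_left, mul_assoc, ← mul_assoc p, hpp,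
        zero_mul, mul_zero]
    · rw [Sum.elim_inl, Sum.elim_inr, ← h'.mul_right, ← h.mul_left, mul_assoc, ← mul_assoc p', hpp',
        zero_mul, mul_zero]
    · exact h'.orth s t fun e => hst (e ▸ rfl)
  · simp [Fintype.sum_sum_type, h.sum, h'.sum]

theorem exists_isMinDecomp {p : Matrix κ κ ℂ} (hs : star p = p) (hp : p * p = p) :
    ∃ (ι : Type) (_ : Fintype ι) (q : ι → Matrix κ κ ℂ), IsMinDecomp p q := by
  have hA : p.IsHermitian := hs
  set T := Unitary.conjStarAlgAut ℂ _ hA.eigenvectorUnitary with hT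
  set d : κ → ℂ := RCLike.ofReal ∘ hA.eigenvalues with hd
  have hpT : p = T (Matrix.diagonal d) := hA.spectral_theorem
  have hdd : ∀ k, d k * d k = d k := by
    intro k
    rw [hpT, ← map_mul] at hp
    have := T.injective hp
    rw [Matrix.diagonal_mul_diagonal] at this
    exact congrFun (Matrix.diagonal_injective this) k
  have htr : ∀ a, (T a).trace = a.trace := by
    intro a
    rw [hT, Unitary.conjStarAlgAut_apply, Matrix.trace_mul_comm, ← mul_assoc]
    simp
  have hidem : ∀ k : κ, T (Matrix.single k k 1) * T (Matrix.single k k 1) = T (Matrix.single k k 1) :=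
    fun k => by rw [← map_mul, Matrix.single_mul_single_same, mul_one]
  -- The eigenvalues of a projection are 0 and 1; the eigenvectors for 1 give the rank one summands.
  refine ⟨{k // d k = 1}, inferInstance, fun k => T (Matrix.single k.1 k.1 1), ?_, ?_, ?_, ?_, ?_⟩
  · intro t
    rw [← map_star]
    simp [Matrix.star_eq_conjTranspose]
  · exact fun t => hidem t.1
  · intro t
    have h := rank_eq_trace _ (hidem t.1)
    rw [htr, Matrix.trace_single_eq_same] at h
    exact_mod_cast h
  · intro s t hst
    rw [← map_mul, Matrix.single_mul_single_of_ne _ _ _ _ (fun e => hst (Subtype.ext e)), map_zero]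
  · rw [hpT, ← map_sum, ← Matrix.sum_single_eq_diagonal]
    have h : ∀ k, Matrix.single k k (d k) = if d k = 1 then Matrix.single k k 1 else 0 := by
      intro k
      split_ifs with hk
      · rw [hk]
      · rcases eq_or_ne (d k) 0 with h0 | h0
        · rw [h0, Matrix.single_zero]
        · exact absurd ((mul_eq_left₀ h0).1 (hdd k)) hk
    simp only [h]
    rw [← Finset.sum_filter]
    exact congrArg T (Finset.sum_subtype (Finset.univ.filter fun k => d k = 1) (fun k => by simp)
      (fun k => Matrix.single k k (1 : ℂ))).symm

/-- The eigenprojections of a symmetry `u` in the corner of `p`. -/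
theorem exists_eigenprojections {p u : Matrix κ κ ℂ} (hs : star p = p) (hp : p * p = p)
    (hus : star u = u) (hu : u * u = p) (hup : u * p = u) (hpu : p * u = u) :
    ∃ P P' : Matrix κ κ ℂ, P + P' = p ∧ P * P' = 0 ∧ P' * P = 0 ∧ P * P = P ∧ P' * P' = P' ∧
      star P = P ∧ star P' = P' ∧ u * P = P ∧ P * u = P ∧ u * P' = -P' ∧ P' * u = -P' ∧
      ∀ v, v * p = p * v → v * u = u * v → v * P = P * v ∧ v * P' = P' * v := by
  have h4 : ∀ x : Matrix κ κ ℂ, (2⁻¹ * 2⁻¹ : ℂ) • (x + x) = (2⁻¹ : ℂ) • x := fun x => by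
    rw [← two_smul ℂ x, smul_smul]; norm_num
  refine ⟨(2⁻¹ : ℂ) • (p + u), (2⁻¹ : ℂ) • (p - u), ?_, ?_, ?_, ?_, ?_, ?_, ?_, ?_, ?_, ?_, ?_, ?_⟩
  · rw [← smul_add, add_add_sub_cancel, ← two_smul ℂ p, smul_smul]; norm_num
  · rw [smul_mul_smul_comm, add_mul, mul_sub, mul_sub, hp, hup, hpu, hu]; simp
  · rw [smul_mul_smul_comm, sub_mul, mul_add, mul_add, hp, hup, hpu, hu]; simp [add_comm]
  · rw [smul_mul_smul_comm, ← h4, add_mul, mul_add, mul_add, hp, hup, hpu, hu]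
    congr 1; abel
  · rw [smul_mul_smul_comm, ← h4, sub_mul, mul_sub, mul_sub, hp, hup, hpu, hu]
    congr 1; abel
  · rw [star_smul, star_add, hs, hus]; simp
  · rw [star_smul, star_sub, hs, hus]; simp
  · rw [mul_smul_comm, mul_add, hup, hu, add_comm u]
  · rw [smul_mul_assoc, add_mul, hpu, hu, add_comm u]
  · rw [mul_smul_comm, mul_sub, hup, hu, ← smul_neg, neg_sub]
  · rw [smul_mul_assoc, sub_mul, hpu, hu, ← smul_neg, neg_sub]
  · intro v hv hv'
    rw [mul_smul_comm, smul_mul_assoc, mul_smul_comm, smul_mul_assoc, mul_add, add_mul, mul_sub,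
      sub_mul, hv, hv']
    exact ⟨rfl, rfl⟩

theorem exists_isMinDecomp_comm {p u : Matrix κ κ ℂ} (hs : star p = p) (hp : p * p = p)
    (hus : star u = u) (hu : u * u = p) (hup : u * p = u) (hpu : p * u = u) :
    ∃ (ι : Type) (_ : Fintype ι) (q : ι → Matrix κ κ ℂ), IsMinDecomp p q ∧ ∀ t, u * q t = q t * u := by
  obtain ⟨P, P', hsum, h1, h2, hi, hi', hsa, hsa', hl, hr, hl', hr', -⟩ :=
    exists_eigenprojections hs hp hus hu hup hpu
  obtain ⟨ι, _, q, hq⟩ := exists_isMinDecomp hsa hi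
  obtain ⟨ι', _, q', hq'⟩ := exists_isMinDecomp hsa' hi'
  refine ⟨ι ⊕ ι', inferInstance, Sum.elim q q', hsum ▸ hq.sumElim hq' h1 h2, ?_⟩
  rintro (t | t)
  · rw [Sum.elim_inl, ← hq.mul_left, ← mul_assoc, hl, hq.mul_left]
    conv_rhs => rw [← hq.mul_right, mul_assoc, hr, hq.mul_right]
  · rw [Sum.elim_inr, ← hq'.mul_left, ← mul_assoc, hl', neg_mul, hq'.mul_left]
    conv_rhs => rw [← hq'.mul_right, mul_assoc, hr', mul_neg, hq'.mul_right]

/-- The symmetry v preserves both eigenspaces of u, and its restriction to each is again a symmetry,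
to which the one-symmetry case applies. -/
theorem exists_isMinDecomp_comm_comm {p u v : Matrix κ κ ℂ} (hs : star p = p) (hp : p * p = p)
    (hus : star u = u) (hu : u * u = p) (hup : u * p = u) (hpu : p * u = u)
    (hvs : star v = v) (hv : v * v = p) (hvp : v * p = v) (hpv : p * v = v) (huv : u * v = v * u) :
    ∃ (ι : Type) (_ : Fintype ι) (q : ι → Matrix κ κ ℂ), IsMinDecomp p q ∧
      (∀ t, u * q t = q t * u) ∧ ∀ t, v * q t = q t * v := by
  obtain ⟨P, P', hsum, h1, h2, hi, hi', hsa, hsa', hl, hr, hl', hr', hc⟩ :=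
    exists_eigenprojections hs hp hus hu hup hpu
  obtain ⟨hvP, hvP'⟩ := hc v (by rw [hvp, hpv]) huv.symm
  have hpP : p * P = P := by rw [← hsum, add_mul, hi, h2, add_zero]
  have hpP' : p * P' = P' := by rw [← hsum, add_mul, hi', h1, zero_add]
  have key : ∀ R : Matrix κ κ ℂ, R * R = R → star R = R → v * R = R * v → p * R = R →
      ∃ (ι : Type) (_ : Fintype ι) (q : ι → Matrix κ κ ℂ), IsMinDecomp R q ∧
      ∀ t, v * q t = q t * v := by
    intro R hR hRs hvR hpR
    obtain ⟨ι, hι, q, hq, hqv⟩ := exists_isMinDecomp_comm hRs hR (u := v * R)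
      (by rw [star_mul, hRs, hvs, hvR])
      (by rw [mul_assoc, ← mul_assoc R, ← hvR, mul_assoc, hR, ← mul_assoc, hv, hpR])
      (by rw [mul_assoc, hR]) (by rw [hvR, ← mul_assoc, hR])
    refine ⟨ι, hι, q, hq, fun t => ?_⟩
    have := hqv t
    rw [mul_assoc, hq.mul_left, hvR, ← mul_assoc, hq.mul_right] at this
    exact this
  obtain ⟨ι, _, q, hq, hqv⟩ := key P hi hsa hvP hpP
  obtain ⟨ι', _, q', hq', hqv'⟩ := key P' hi' hsa' hvP' hpP'
  refine ⟨ι ⊕ ι', inferInstance, Sum.elim q q', hsum ▸ hq.sumElim hq' h1 h2, ?_, ?_⟩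
  · rintro (t | t)
    · rw [Sum.elim_inl, ← hq.mul_left, ← mul_assoc, hl, hq.mul_left]
      conv_rhs => rw [← hq.mul_right, mul_assoc, hr, hq.mul_right]
    · rw [Sum.elim_inr, ← hq'.mul_left, ← mul_assoc, hl', neg_mul, hq'.mul_left]
      conv_rhs => rw [← hq'.mul_right, mul_assoc, hr', mul_neg, hq'.mul_right]
  · rintro (t | t); exacts [hqv t, hqv' t]

end Decomposition

/-! ### Compression to projections of the commutant, and regularity -/

/-- A *-homomorphism which maps one 4-cycle algebra into the other restricts to a homomorphism of
4-cycle algebras. -/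
def MapsAlg.toHom {Φ : StarHom n m} (h : MapsAlg Φ) : Hom n m where
  toFun a := ⟨Φ a, h a a.2⟩
  map_smul' c a := Subtype.ext (map_smul Φ c (a : Full n))
  map_zero' := Subtype.ext (map_zero Φ)
  map_add' a b := Subtype.ext (map_add Φ (a : Full n) b)
  map_mul' a b := Subtype.ext (map_mul Φ (a : Full n) b)

/-- The compression of `Φ` to a projection of its relative commutant. -/
def cutDown (Φ : StarHom n m) (q : Full m) (hq : q ∈ relCommutant Φ) (hs : star q = q)
    (hi : q * q = q) : StarHom n m where
  toFun a := q * Φ a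
  map_smul' c a := by rw [map_smul, mul_smul_comm]; rfl
  map_zero' := by rw [map_zero, mul_zero]
  map_add' a b := by rw [map_add, mul_add]
  map_mul' a b := by
    rw [map_mul, mul_assoc q, ← mul_assoc (Φ a), ← relCommutant_comm hq, mul_assoc q, ← mul_assoc q q, hi]
  map_star' a := by
    change q * Φ (star a) = star (q * Φ a)
    rw [star_mul, hs, ← map_star, relCommutant_comm hq]

theorem SymmAt.comm_blockProj {Φ : StarHom n m} {a b c : Fin 4} (hab : a ≠ b) (hc : c = a ∨ c = b)
    {U q : Full m} (hU : SymmAt Φ a b U) (hq : q ∈ relCommutant Φ) (hqU : U * q = q * U) :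
    blockProj m c * Φ 1 * q = q * (blockProj m c * Φ 1) := by
  have hs : ∀ x : Full n, Φ x * q = q * Φ x := fun x => (relCommutant_comm hq x).symm
  have h1 : (blockProj m a + blockProj m b) * Φ 1 * q = q * ((blockProj m a + blockProj m b) * Φ 1) := by
    rw [hU.sum, hs]
  have h2 : (blockProj m a - blockProj m b) * Φ 1 * q = q * ((blockProj m a - blockProj m b) * Φ 1) := by
    rw [hU.diff, mul_assoc, hqU, ← mul_assoc, hs, mul_assoc]
  have ha : blockProj m a = (2⁻¹ : ℂ) • ((blockProj m a + blockProj m b) + (blockProj m a - blockProj m b)) := by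
    rw [add_add_sub_cancel, ← two_smul ℂ, smul_smul]; norm_num
  have hb : blockProj m b = (2⁻¹ : ℂ) • ((blockProj m a + blockProj m b) - (blockProj m a - blockProj m b)) := by
    rw [add_sub_sub_cancel, ← two_smul ℂ, smul_smul]; norm_num
  rcases hc with rfl | rfl
  · rw [ha, smul_mul_assoc, smul_mul_assoc, mul_smul_comm, add_mul _ _ (Φ 1), add_mul, mul_add, h1, h2]
  · rw [hb, smul_mul_assoc, smul_mul_assoc, mul_smul_comm, sub_mul _ _ (Φ 1), sub_mul, mul_sub, h1, h2]

/-- On the support of Φ each range block projection is half a sum or difference of elements of Φ(M)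
and Φ(M)U or Φ(M)V, so anything commuting with Φ, U and V commutes with the blocks. -/
theorem SymmAt.isBlockDiag {Φ : StarHom n m} (hΦ : MapsAlg Φ)
    {U V q : Full m} (hU : SymmAt Φ 0 1 U) (hV : SymmAt Φ 2 3 V) (hq : q ∈ relCommutant Φ)
    (hqU : U * q = q * U) (hqV : V * q = q * V) : IsBlockDiag q := by
  rw [isBlockDiag_iff]
  intro v
  have h : blockProj m v * Φ 1 * q = q * (blockProj m v * Φ 1) := by
    by_cases hv : v < 2
    · exact hU.comm_blockProj (by decide) (by revert v; decide) hq hqU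
    · exact hV.comm_blockProj (by decide) (by revert v; decide) hq hqV
  rwa [(hΦ.isBlockDiag isBlockDiag_one).comm, ← mul_assoc q, relCommutant_mul_one hq,
    ← (hΦ.isBlockDiag isBlockDiag_one).comm, mul_assoc, relCommutant_one_mul hq] at h

theorem isRegular_of_commute {φ : Hom n m} {Φ : StarHom n m} (hφ : ∀ a : Alg n, Φ a = φ a)
    {U V : Full m} (hU : SymmAt Φ 0 1 U) (hV : SymmAt Φ 2 3 V) (hUV : U * V = V * U) :
    IsRegular φ := by
  have hΦ : MapsAlg Φ := fun a ha => by rw [hφ ⟨a, ha⟩]; exact (φ ⟨a, ha⟩).2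
  set o := Idx.first n 0 with ho
  set p := Φ (Matrix.single o o 1) with hp
  have hpp : p * p = p := by rw [hp, ← map_mul, Matrix.single_mul_single_same, mul_one]
  have hps : star p = p := by rw [hp, ← map_star]; simp [Matrix.star_eq_conjTranspose]
  have hUp : U * p = p * U := relCommutant_comm hU.mem _
  have hVp : V * p = p * V := relCommutant_comm hV.mem _
  have h1p : Φ 1 * p = p := by rw [hp, ← map_mul, one_mul]
  have hmul : ∀ X Y : Full m, Y * p = p * Y → (X * p) * (Y * p) = X * Y * p := fun X Y h => by
    rw [mul_assoc, ← mul_assoc p, ← h, mul_assoc, hpp, ← mul_assoc]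
  have hcor : ∀ X : Full m, X * p = p * X → X * X = Φ 1 → (X * p) * (X * p) = p := fun X h h' => by
    rw [hmul X X h, h', h1p]
  obtain ⟨ι, _, q, hq, hqU, hqV⟩ := exists_isMinDecomp_comm_comm hps hpp (u := U * p) (v := V * p)
    (by rw [star_mul, hps, hU.star_eq, hUp]) (hcor U hUp hU.sq) (by rw [mul_assoc, hpp])
    (by rw [hUp, ← mul_assoc, hpp]) (by rw [star_mul, hps, hV.star_eq, hVp]) (hcor V hVp hV.sq)
    (by rw [mul_assoc, hpp]) (by rw [hVp, ← mul_assoc, hpp])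
    (by rw [hmul U V hVp, hmul V U hUp, hUV])
  have hcomm : ∀ X ∈ relCommutant Φ, (∀ t, (X * p) * q t = q t * (X * p)) →
      ∀ t, X * spread Φ o (q t) = spread Φ o (q t) * X := by
    intro X hX h t
    have h' : X * q t = q t * X := by
      have := h t
      rwa [mul_assoc, hq.mul_left, relCommutant_comm hX, ← mul_assoc, hq.mul_right] at this
    rw [spread, Finset.mul_sum, Finset.sum_mul]
    refine Finset.sum_congr rfl fun y _ => ?_
    rw [← mul_assoc, ← mul_assoc, relCommutant_comm hX, mul_assoc _ X, h', ← mul_assoc, mul_assoc _ X,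
      relCommutant_comm hX, ← mul_assoc]
  have hmem : ∀ t, spread Φ o (q t) ∈ relCommutant Φ := fun t => spread_mem_relCommutant _ _
  have hstar : ∀ t, star (spread Φ o (q t)) = spread Φ o (q t) := fun t => by
    rw [star_spread, hq.star_eq]
  have hidem : ∀ t, spread Φ o (q t) * spread Φ o (q t) = spread Φ o (q t) := fun t => by
    rw [spread_mul_spread, hq.mul_right, hq.idem]
  have hmaps : ∀ t, MapsAlg (cutDown Φ _ (hmem t) (hstar t) (hidem t)) := fun t a ha =>
    mul_mem (SymmAt.isBlockDiag hΦ hU hV (hmem t) (hcomm U hU.mem hqU t)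
      (hcomm V hV.mem hqV t)).mem_alg (hΦ a ha)
  let e := Fintype.equivFin ι
  refine ⟨Fintype.card ι, fun t => (hmaps (e.symm t)).toHom, fun t => ⟨⟨_, fun a => rfl⟩, ?_⟩, ?_, ?_⟩
  · change (spread Φ o (q (e.symm t)) * Φ (Matrix.single o o 1)).rank = 1
    rw [spread_mul_map_single]
    change (p * _ * p).rank = 1
    rw [hq.mul_left, hq.mul_right, hq.rank]
  · intro s t hst
    refine Subtype.ext ?_
    change spread Φ o (q (e.symm s)) * Φ 1 * (spread Φ o (q (e.symm t)) * Φ 1) = 0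
    rw [relCommutant_mul_one (hmem _), relCommutant_mul_one (hmem _), spread_mul_spread, hq.mul_right,
      hq.orth _ _ (fun h => hst (e.symm.injective h))]
    simp [spread]
  · intro a
    refine Subtype.ext ?_
    have h1 : ∑ t, spread Φ o (q t) = Φ 1 := by
      rw [← spread_map_single_self o]
      change _ = spread Φ o p
      simp only [spread]
      rw [Finset.sum_comm]
      refine Finset.sum_congr rfl fun y _ => ?_
      rw [← hq.sum, Finset.mul_sum, Finset.sum_mul]
    have h2 : ((∑ t, (hmaps (e.symm t)).toHom a : Alg m) : Full m)
        = ∑ t, spread Φ o (q (e.symm t)) * Φ a := by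
      rw [AddSubmonoidClass.coe_finsetSum]
      rfl
    rw [h2, Equiv.sum_comp e.symm (fun t => spread Φ o (q t) * Φ a), ← Finset.sum_mul, h1, ← map_mul, one_mul, hφ]

/-! ### Extensions -/

/-- `Φ` is a *-homomorphism extending `φ`. -/
def Extends (Φ : StarHom n m) (φ : Hom n m) : Prop := ∀ a : Alg n, Φ a = φ a

theorem Extends.mapsAlg {Φ : StarHom n m} {φ : Hom n m} (h : Extends Φ φ) : MapsAlg Φ := fun a ha => by
  rw [h ⟨a, ha⟩]; exact (φ ⟨a, ha⟩).2

theorem Extends.unique {Φ Φ' : StarHom n m} {φ : Hom n m} (h : Extends Φ φ) (h' : Extends Φ' φ) :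
    Φ = Φ' := by
  ext1 a
  refine alg_induction (p := fun a => Φ a = Φ' a) (fun a ha => ?_) (fun a b ha hb => ?_)
    (fun a b ha hb => ?_) (fun a ha => ?_) a
  · rw [h ⟨a, ha⟩, h' ⟨a, ha⟩]
  · rw [map_add, map_add, ha, hb]
  · rw [map_mul, map_mul, ha, hb]
  · rw [map_star, map_star, ha]

theorem Extends.comp {Φ : StarHom n m} {φ : Hom n m} {Ψ : StarHom m l} {ψ : Hom m l}
    (h : Extends Φ φ) (h' : Extends Ψ ψ) : Extends (Ψ.comp Φ) (ψ.comp φ) := fun a => by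
  change Ψ (Φ a) = ψ (φ a)
  rw [h, h']

theorem Extends.map_single_ne_zero {Φ : StarHom n m} {φ : Hom n m} (h : Extends Φ φ)
    (hφ : Function.Injective φ) (x : Idx n) : Φ (Matrix.single x x 1) ≠ 0 := by
  intro h0
  have hx : Matrix.single x x (1 : ℂ) ∈ Alg n := single_mem_alg (Or.inl rfl)
  have h1 := h ⟨_, hx⟩
  rw [h0] at h1
  have h2 : (⟨_, hx⟩ : Alg n) = 0 := hφ (by rw [map_zero]; exact Subtype.ext h1.symm)
  simpa using congrFun (congrFun (congrArg Subtype.val h2) x) x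

theorem map_one_ne_zero_of_single {Φ : StarHom n m} (h : ∀ x, Φ (Matrix.single x x 1) ≠ 0) : Φ 1 ≠ 0 :=
  fun h0 => h (Idx.first n 0) (by rw [← one_mul (Matrix.single _ _ _), map_mul, h0, zero_mul])

/-! ### Multiplicity -/

theorem Extends.multiplicity_eq {Φ : StarHom n m} {φ : Hom n m} (h : Extends Φ φ) :
    (multiplicity φ : ℂ) = (Φ (Matrix.single (Idx.first n 0) (Idx.first n 0) 1)).trace := by
  rw [← rank_eq_trace _ (by rw [← map_mul, Matrix.single_mul_single_same, mul_one])]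
  exact congrArg (fun M : Full m => ((M.rank : ℕ) : ℂ)) (h (matUnit n 0 0 (Or.inl rfl))).symm

theorem multiplicity_comp {Φ : StarHom n m} {φ : Hom n m} {Ψ : StarHom m l} {ψ : Hom m l}
    (h : Extends Φ φ) (h' : Extends Ψ ψ) :
    multiplicity (ψ.comp φ) = multiplicity φ * multiplicity ψ := by
  have key := trace_map_mul (Φ := Ψ) map_one_mem_relCommutant (Idx.first m 0)
    (Φ (Matrix.single (Idx.first n 0) (Idx.first n 0) 1))
  rw [← map_mul, ← map_mul, mul_one, mul_one, ← h.multiplicity_eq, ← h'.multiplicity_eq] at key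
  have h2 := (h.comp h').multiplicity_eq
  rw [NonUnitalStarAlgHom.comp_apply, key] at h2
  exact_mod_cast h2

/-- Conjugation by U negates V, so V is traceless on the minimal corner p; its two eigenprojections
there have equal rank and sum to p. -/
theorem even_multiplicity {Φ : StarHom n m} {φ : Hom n m} (h : Extends Φ φ) {U V : Full m}
    (hU : SymmAt Φ 0 1 U) (hV : SymmAt Φ 2 3 V) (hUV : U * V = -(V * U)) :
    Even (multiplicity φ) := by
  have hm := h.multiplicity_eq
  set o := Idx.first n 0 with ho
  set p := Φ (Matrix.single o o 1) with hp
  have hpp : p * p = p := by rw [hp, ← map_mul, Matrix.single_mul_single_same, mul_one]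
  have hps : star p = p := by rw [hp, ← map_star]; simp [Matrix.star_eq_conjTranspose]
  have hUp : U * p = p * U := relCommutant_comm hU.mem _
  have hVp : V * p = p * V := relCommutant_comm hV.mem _
  have h1p : Φ 1 * p = p := by rw [hp, ← map_mul, one_mul]
  obtain ⟨P, P', hsum, -, -, hi, -, -, -, h1, -, h2, -, -⟩ := exists_eigenprojections (u := V * p) hps hpp
    (by rw [star_mul, hps, hV.star_eq, hVp])
    (by rw [mul_assoc, ← mul_assoc p, ← hVp, mul_assoc, hpp, ← mul_assoc, hV.sq, h1p])
    (by rw [mul_assoc, hpp]) (by rw [hVp, ← mul_assoc, hpp])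
  have ht : (V * p).trace = 0 := by
    have e1 : U * (V * p) * U = -(V * p) := by
      rw [← mul_assoc U, hUV, neg_mul, neg_mul, mul_assoc V, hUp, mul_assoc, mul_assoc, hU.sq,
        hp, ← map_mul, mul_one]
    have e2 := congrArg Matrix.trace e1
    rw [Matrix.trace_mul_comm, ← mul_assoc, hU.sq, ← mul_assoc, relCommutant_one_mul hV.mem,
      Matrix.trace_neg] at e2
    exact self_eq_neg.1 e2
  have hd : V * p = P - P' := by
    rw [sub_eq_add_neg, ← h1, ← h2, ← mul_add, hsum, mul_assoc, hpp]
  rw [hd, Matrix.trace_sub, sub_eq_zero] at ht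
  rw [← hsum, Matrix.trace_add, ← ht, ← rank_eq_trace P hi] at hm
  exact ⟨P.rank, by exact_mod_cast hm⟩

theorem trace_eq_zero_of_anticommute {Φ : StarHom n m} {U V : Full m} (hU : U ∈ relCommutant Φ)
    (hUV : U * V = -(V * U)) (a : Full n) : (Φ a * (U * V)).trace = 0 := by
  have h : (Φ a * (V * U)).trace = (Φ a * (U * V)).trace := by
    rw [← mul_assoc, Matrix.trace_mul_comm, ← mul_assoc, relCommutant_comm hU, mul_assoc]
  have h2 := congrArg (fun M => (Φ a * M).trace) hUV
  simp only [mul_neg, Matrix.trace_neg, h] at h2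
  exact self_eq_neg.1 h2

/-- Up to order, the product of the composed symmetries is UV ⊗ U'V', so its trace factors. This
multiplicativity matches that of the action on H₁. -/
theorem trace_comp {Φ : StarHom n m} {Ψ : StarHom m l} {U V : Full m} {U' V' : Full l}
    (hU' : U' ∈ relCommutant Ψ) (hV' : V' ∈ relCommutant Ψ) (a : Full n) :
    (Ψ.comp Φ a * ((Ψ U * U') * (Ψ V * V'))).trace = (Φ a * (U * V)).trace *
      (Ψ (Matrix.single (Idx.first m 0) (Idx.first m 0) 1) * (U' * V')).trace := by
  rw [← trace_map_mul (mul_mem hU' hV')]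
  congr 1
  rw [NonUnitalStarAlgHom.comp_apply, map_mul_mul_map_mul hU', map_mul Ψ (Φ a), mul_assoc]

/-! ### Rigid embeddings -/

/-- The sign of the action of `g` on the pair of vertices containing `a`. -/
def Symm.sign (g : Symm) (a : Fin 4) : ℤ := if g.1 a = a then 1 else -1

theorem Symm.sign_mul_self (g : Symm) (a : Fin 4) : g.sign a * g.sign a = 1 := by
  unfold Symm.sign; split_ifs <;> norm_num

theorem Symm.cases (g : Symm) : ((g.1 0 = 0 ∧ g.1 1 = 1) ∨ (g.1 0 = 1 ∧ g.1 1 = 0)) ∧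
    ((g.1 2 = 2 ∧ g.1 3 = 3) ∨ (g.1 2 = 3 ∧ g.1 3 = 2)) := by
  have h : ∀ a b c d : Fin 4, a ≠ b → c ≠ d → a ≠ c → a ≠ d → b ≠ c → b ≠ d → Edge a c → Edge a d →
      Edge b c → Edge b d → ((a = 0 ∧ b = 1) ∨ (a = 1 ∧ b = 0)) ∧
      ((c = 2 ∧ d = 3) ∨ (c = 3 ∧ d = 2)) := by decide
  have hne : ∀ i j : Fin 4, i ≠ j → g.1 i ≠ g.1 j := fun i j hij h => hij (g.1.injective h)
  apply h <;> first
    | exact hne _ _ (by decide)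
    | exact (g.2 _ _).2 (by decide)

theorem sum_pEdge {M : Type*} [AddCommMonoid M] (f : PEdge → M) :
    ∑ e, f e = f ⟨(0, 2), by decide⟩ + f ⟨(0, 3), by decide⟩ + f ⟨(1, 2), by decide⟩
      + f ⟨(1, 3), by decide⟩ := by
  have h : (Finset.univ : Finset PEdge) = {⟨(0, 2), by decide⟩, ⟨(0, 3), by decide⟩,
      ⟨(1, 2), by decide⟩, ⟨(1, 3), by decide⟩} := by decide
  rw [h, Finset.sum_insert (by decide), Finset.sum_insert (by decide), Finset.sum_insert (by decide),
    Finset.sum_singleton]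
  simp only [add_assoc]

/-- Every cycle is a multiple of 02 - 03 - 12 + 13, and exchanging the two sources, or the two
sinks, reverses its sign. -/
theorem symm_chain (g : Symm) {c : PEdge → ℤ} (hc : c ∈ H1) (f : PEdge) :
    (∑ e : PEdge, c e * (if g.1 e.1.1 = f.1.1 ∧ g.1 e.1.2 = f.1.2 then 1 else 0))
      = g.sign 0 * g.sign 2 * c f := by
  have hb : ∀ v, boundary c v = 0 := fun v => by rw [LinearMap.mem_ker.1 hc]; rfl
  simp only [boundary, LinearMap.coe_mk, AddHom.coe_mk, sum_pEdge] at hb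
  have h0 := hb 0
  have h1 := hb 1
  have h2 := hb 2
  simp at h0 h1 h2
  rw [sum_pEdge]
  have hf : f ∈ (Finset.univ : Finset PEdge) := Finset.mem_univ f
  have h : (Finset.univ : Finset PEdge) = {⟨(0, 2), by decide⟩, ⟨(0, 3), by decide⟩,
      ⟨(1, 2), by decide⟩, ⟨(1, 3), by decide⟩} := by decide
  rw [h] at hf
  simp only [Finset.mem_insert, Finset.mem_singleton] at hf
  unfold Symm.sign
  obtain ⟨⟨a0, a1⟩ | ⟨a0, a1⟩, ⟨a2, a3⟩ | ⟨a2, a3⟩⟩ := g.cases <;>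
    rcases hf with rfl | rfl | rfl | rfl <;> simp [a0, a1, a2, a3] <;> omega

/-- The symmetries are the sums of the supports of the summands, weighted by the signs of their
types on {0,1} and on {2,3}. Each summand contributes the product of its two signs to the trace,
which is exactly its action on H₁. -/
theorem exists_symmAt_of_isRigid {Φ : StarHom n m} {φ : Hom n m} (h : Extends Φ φ) (hr : IsRigid φ) :
    ∃ U V, SymmAt Φ 0 1 U ∧ SymmAt Φ 2 3 V ∧ U * V = V * U ∧
      ∃ c : ℤ, (c : ℂ) = (Φ (Matrix.single (Idx.first n 0) (Idx.first n 0) 1) * (U * V)).trace ∧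
        ∀ x, H1map φ hr x = c • x := by
  obtain ⟨N, θ, g, hθ, hs⟩ := id hr
  choose Θ hΘ using fun t => (hθ t).1.1
  have hq : ∀ s t, s ≠ t → Θ s 1 * Θ t 1 = 0 := fun s t hst => by
    have := congrArg (fun x : Alg m => (x : Full m)) (hs.1 s t hst)
    simp only [MulMemClass.coe_mul] at this
    rw [← hΘ, ← hΘ] at this
    exact this
  have hcross : ∀ s t, s ≠ t → ∀ a b, Θ s a * Θ t b = 0 := fun s t hst a b => by
    rw [← mul_one a, ← one_mul b, map_mul, map_mul, mul_assoc, ← mul_assoc (Θ s 1), hq s t hst,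
      zero_mul, mul_zero]
  have hmul : ∀ a b, (∑ t, Θ t a) * (∑ t, Θ t b) = ∑ t, Θ t (a * b) := fun a b => by
    rw [Finset.sum_mul_sum]
    refine Finset.sum_congr rfl fun s _ => ?_
    rw [Finset.sum_eq_single_of_mem s (Finset.mem_univ _) fun t _ hts => hcross s t hts.symm _ _, map_mul]
  have hΦ : ∀ a, Φ a = ∑ t, Θ t a := by
    refine alg_induction (fun a ha => ?_) (fun a b ha hb => ?_) (fun a b ha hb => ?_) (fun a ha => ?_)
    · rw [h ⟨a, ha⟩, hs.2, AddSubmonoidClass.coe_finsetSum]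
      exact Finset.sum_congr rfl fun t _ => (hΘ t ⟨a, ha⟩).symm
    · simp only [map_add, ha, hb, Finset.sum_add_distrib]
    · rw [map_mul, ha, hb, hmul]
    · simp only [map_star, ha, star_sum]
  have hqΦ : ∀ t a, Θ t 1 * Φ a = Θ t a := fun t a => by
    rw [hΦ, Finset.mul_sum, Finset.sum_eq_single_of_mem t (Finset.mem_univ _)
      fun s _ hst => hcross t s hst.symm _ _, ← map_mul, one_mul]
  have hΦq : ∀ t a, Φ a * Θ t 1 = Θ t a := fun t a => by
    rw [hΦ, Finset.sum_mul, Finset.sum_eq_single_of_mem t (Finset.mem_univ _)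
      fun s _ hst => hcross s t hst _ _, ← map_mul, mul_one]
  -- The combinations `D ε` form a commutative algebra in the commutant, in which both symmetries
  -- lie.
  let D : (Fin N → ℤ) → Full m := fun ε => ∑ t, ε t • Θ t 1
  have hqmem : ∀ t, Θ t 1 ∈ relCommutant Φ := fun t => ⟨fun a => by rw [hqΦ, hΦq], hqΦ t 1⟩
  have hDmem : ∀ ε, D ε ∈ relCommutant Φ := fun ε => sum_mem fun t _ => zsmul_mem (hqmem t) _
  have hDstar : ∀ ε, star (D ε) = D ε := fun ε => by
    simp only [D, star_sum, star_smul, star_trivial]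
    exact Finset.sum_congr rfl fun t _ => by rw [← map_star, star_one]
  have hDmul : ∀ ε δ, D ε * D δ = D fun t => ε t * δ t := fun ε δ => by
    simp only [D, Finset.sum_mul_sum]
    refine Finset.sum_congr rfl fun s _ => ?_
    rw [Finset.sum_eq_single_of_mem s (Finset.mem_univ _)]
    · rw [smul_mul_smul_comm, ← map_mul, mul_one]
    · intro t _ hts
      rw [smul_mul_smul_comm, hq s t hts.symm, smul_zero]
  have hDΦ : ∀ ε a, Φ a * D ε = ∑ t, ε t • Θ t a := fun ε a => by
    simp only [D, Finset.mul_sum, mul_smul_comm, hΦq]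
  have hblock : ∀ t v, blockProj m ((g t).1 v) * Θ t 1 = Θ t (blockProj n v) := by
    intro t v
    have hin : ∀ i, InBlock ((g t).1 i) ((g t).1 i) (Θ t (blockProj n i)) := by
      intro i
      have := (hθ t).2 i i ⟨_, (isBlockDiag_blockProj i).mem_alg⟩ (by
        intro x y hxy
        simp only [blockProj, Matrix.diagonal_apply] at hxy
        grind)
      rwa [← hΘ] at this
    rw [← sum_blockProj, map_sum, Finset.mul_sum, Finset.sum_eq_single_of_mem v (Finset.mem_univ _)]
    · ext x y
      rw [blockProj_mul_apply]
      split_ifs with hx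
      · rfl
      · by_contra hne
        exact hx (hin v x y (Ne.symm hne)).1
    · intro i _ hi
      ext x y
      rw [blockProj_mul_apply]
      split_ifs with hx
      · by_contra hne
        exact hi ((g t).1.injective ((hin i x y hne).1.symm.trans hx))
      · rfl
  have hsymm : ∀ a b : Fin 4, (∀ t, ((g t).1 a = a ∧ (g t).1 b = b) ∨ ((g t).1 a = b ∧ (g t).1 b = a)) →
      a ≠ b → SymmAt Φ a b (D fun t => (g t).sign a) := by
    intro a b hab hne
    refine ⟨hDmem _, hDstar _, ?_, ?_, ?_⟩
    · rw [hDmul]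
      simp only [Symm.sign_mul_self, D, one_smul, hΦ]
    · rw [hDΦ, hΦ, Finset.mul_sum]
      refine Finset.sum_congr rfl fun t _ => ?_
      rw [map_sub, ← hblock, ← hblock, ← sub_mul]
      rcases hab t with ⟨h1, h2⟩ | ⟨h1, h2⟩
      · rw [h1, h2, Symm.sign, if_pos h1, one_smul]
      · rw [h1, h2, Symm.sign, if_neg (by rw [h1]; exact hne.symm), neg_smul, one_smul, ← neg_mul, neg_sub]
    · rw [hΦ, hΦ, Finset.mul_sum]
      refine Finset.sum_congr rfl fun t _ => ?_
      rw [map_add, ← hblock, ← hblock, ← add_mul]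
      rcases hab t with ⟨h1, h2⟩ | ⟨h1, h2⟩
      · rw [h1, h2]
      · rw [h1, h2, add_comm]
  refine ⟨_, _, hsymm 0 1 (fun t => (g t).cases.1) (by decide),
    hsymm 2 3 (fun t => (g t).cases.2) (by decide), ?_, ∑ t, (g t).sign 0 * (g t).sign 2, ?_, ?_⟩
  · rw [hDmul, hDmul]
    simp only [mul_comm]
  · rw [hDmul, hDΦ, Matrix.trace_sum, Int.cast_sum]
    refine Finset.sum_congr rfl fun t _ => ?_
    have h1 : ((1 : ℕ) : ℂ) = _ := (hθ t).1.2 ▸ Extends.multiplicity_eq (hΘ t)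
    rw [Matrix.trace_smul, ← h1, zsmul_eq_mul, Nat.cast_one, mul_one]
  · intro x
    refine Subtype.ext (funext fun f => ?_)
    change chainMap φ x f = _
    simp only [chainMap, LinearMap.coe_mk, AddHom.coe_mk]
    have : ∀ e : PEdge, (x : PEdge → ℤ) e *
        ((block f.1.1 f.1.2 (φ (matUnit n e.1.1 e.1.2 e.2.1) : Full m)).rank : ℤ) = ∑ t, (x : PEdge → ℤ) e *
          (if (g t).1 e.1.1 = f.1.1 ∧ (g t).1 e.1.2 = f.1.2 then 1 else 0) := fun e => by
      rw [rank_block hθ hs, ← Finset.mul_sum]; push_cast; rfl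
    simp only [this]
    rw [Finset.sum_comm]
    simp only [symm_chain _ x.2]
    rw [← Finset.sum_mul]
    rfl

theorem extends_id (n : Fin 4 → ℕ+) :
    Extends (NonUnitalStarAlgHom.id ℂ (Full n)) (NonUnitalAlgHom.id ℂ (Alg n)) := fun _ => rfl

theorem symmAt_id (n : Fin 4 → ℕ+) (a b : Fin 4) : SymmAt (NonUnitalStarAlgHom.id ℂ (Full n)) a b 1 :=
  ⟨⟨fun a => by rw [one_mul, mul_one], one_mul _⟩, star_one _, one_mul _, rfl, mul_one _⟩

theorem SymmAt.false_of_commute_of_anticommute {n m : Fin 4 → ℕ+} {Φ : StarHom n m} {a b c d : Fin 4}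
    {U V : Full m} (hΦ1 : Φ 1 ≠ 0) (hU : SymmAt Φ a b U) (hV : SymmAt Φ c d V)
    (h : U * V = V * U) (h' : U * V = -(V * U)) : False := by
  rw [← h] at h'
  have h0 : U * V = 0 := by
    have h2 : (2 : ℂ) • (U * V) = 0 := by rw [two_smul]; exact add_eq_zero_iff_eq_neg.2 h'
    exact (smul_eq_zero.1 h2).resolve_left two_ne_zero
  refine hΦ1 ?_
  have h1 : (U * V) * (V * U) = Φ 1 := by
    rw [mul_assoc, ← mul_assoc V, hV.sq, ← mul_assoc, relCommutant_mul_one hU.mem, hU.sq]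
  rw [← h1, h0, zero_mul]

/-! ### Symmetries, homology and multiplicity along a system -/

namespace System

variable (S : System)

theorem trans_self (k : ℕ) : S.trans (le_refl k) = NonUnitalAlgHom.id ℂ (Alg (S.size k)) :=
  Nat.leRec_self ..

theorem trans_succ {k l : ℕ} (h : k ≤ l) :
    S.trans (Nat.le_succ_of_le h) = (S.map l).comp (S.trans h) := Nat.leRec_succ ..

theorem H1trans_self (hS : S.IsRigid) (k : ℕ) : S.H1trans hS (le_refl k) = LinearMap.id :=
  Nat.leRec_self ..

theorem H1trans_succ (hS : S.IsRigid) {k l : ℕ} (h : k ≤ l) :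
    S.H1trans hS (Nat.le_succ_of_le h) = (H1map (S.map l) (hS l)).comp (S.H1trans hS h) :=
  Nat.leRec_succ ..

/-- The symmetries multiply as tensors along the system, which preserves commutation, while the
traces and the scalars on H₁ multiply in the same way. An even product of multiplicities has an even
factor. -/
theorem exists_symmAt_trans (hS : S.IsRigid) {k l : ℕ} (h : k ≤ l) :
    ∃ Φ : StarHom (S.size k) (S.size l), Extends Φ (S.trans h) ∧ ∃ U V, SymmAt Φ 0 1 U ∧
      SymmAt Φ 2 3 V ∧ U * V = V * U ∧ (∃ c : ℤ, (c : ℂ) = (Φ (Matrix.single (Idx.first _ 0)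
        (Idx.first _ 0) 1) * (U * V)).trace ∧ ∀ x, S.H1trans hS h x = c • x) ∧
      (Even (multiplicity (S.trans h)) → ∃ i, k ≤ i ∧ Even (multiplicity (S.map i))) := by
  induction l, h using Nat.le_induction with
  | base =>
    refine ⟨_, S.trans_self k ▸ extends_id _, 1, 1, symmAt_id _ _ _, symmAt_id _ _ _, rfl,
      ⟨1, ?_, fun x => ?_⟩, fun he => ?_⟩
    · rw [mul_one, mul_one, Int.cast_one]
      exact (Matrix.trace_single_eq_same _ _).symm
    · rw [H1trans_self, one_smul]; rfl
    · have h1 := (extends_id (S.size k)).multiplicity_eq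
      rw [trans_self] at he
      have h2 : multiplicity (NonUnitalAlgHom.id ℂ (Alg (S.size k))) = 1 := by
        have h2 := h1.trans (Matrix.trace_single_eq_same _ _)
        exact_mod_cast h2
      rw [h2] at he
      exact absurd he (by decide)
  | succ l h ih =>
    obtain ⟨Φ, hΦ, U, V, hU, hV, hUV, ⟨c, hc, hcx⟩, he⟩ := ih
    obtain ⟨Ψ, hΨ⟩ := (S.isStarEmbedding l).2
    replace hΨ : Extends Ψ (S.map l) := hΨ
    obtain ⟨U', V', hU', hV', hUV', c', hc', hcx'⟩ := exists_symmAt_of_isRigid hΨ (hS l)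
    refine ⟨Ψ.comp Φ, S.trans_succ h ▸ hΦ.comp hΨ, _, _, hU.comp hU', hV.comp hV', ?_,
      ⟨c * c', ?_, fun x => ?_⟩, fun h2 => ?_⟩
    · rw [map_mul_mul_map_mul hU'.mem, map_mul_mul_map_mul hV'.mem, hUV, hUV']
    · rw [trace_comp hU'.mem hV'.mem, ← hc, ← hc', Int.cast_mul]
    · rw [S.H1trans_succ hS h, LinearMap.comp_apply, hcx', hcx, smul_smul, mul_comm]
    · rw [S.trans_succ h, multiplicity_comp hΦ hΨ, Nat.even_mul] at h2
      rcases h2 with h2 | h2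
      · exact he h2
      · exact ⟨l, h, h2⟩

theorem subsingleton_H1lim (hS : S.IsRigid) {n : ℕ → ℕ} (hn : StrictMono n) {k : ℕ}
    (h : ∀ j, k ≤ j → ∀ x, S.H1trans hS (hn j.lt_succ_self).le x = 0) : Subsingleton (S.H1lim hS) := by
  have hz : ∀ z : S.H1lim hS, z = 0 := by
    intro z
    obtain ⟨i, x, rfl⟩ := Module.DirectLimit.exists_of z
    -- A representative is pushed to a stage of the subsequence at or beyond k, where the next
    -- transition kills it.
    have hij : i ≤ n (max i k) := (le_max_left i k).trans (hn.id_le _)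
    rw [← Module.DirectLimit.of_f (hij := hij),
      ← Module.DirectLimit.of_f (hij := (hn (max i k).lt_succ_self).le), h _ (le_max_right i k), map_zero]
  exact ⟨fun a b => by rw [hz a, hz b]⟩

end System

/-! ### The crossover maps of an isomorphism -/

/-- Separation of the sides descends only to the first factor of a composition, so the middle map
needs the following map Χ as well. -/
theorem exists_symmAt_of_comp_comp {n m l k : Fin 4 → ℕ+} {Φ : StarHom n m} {Ψ : StarHom m l} {Χ : StarHom l k}
    (hΦ : MapsAlg Φ) (hΨ : MapsAlg Ψ) (hΧ : MapsAlg Χ)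
    (hΦ0 : ∀ x, Φ (Matrix.single x x 1) ≠ 0) (hΨ0 : ∀ x, Ψ (Matrix.single x x 1) ≠ 0)
    (hΧ0 : ∀ x, Χ (Matrix.single x x 1) ≠ 0) {W W' : Full l} {Z Z' : Full k}
    (hW : SymmAt (Ψ.comp Φ) 0 1 W) (hW' : SymmAt (Ψ.comp Φ) 2 3 W')
    (hZ : SymmAt (Χ.comp Ψ) 0 1 Z) (hZ' : SymmAt (Χ.comp Ψ) 2 3 Z') :
    ((∃ U, SymmAt Φ 0 1 U) ∧ ∃ U, SymmAt Φ 2 3 U) ∧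
      ((∃ U, SymmAt Ψ 0 1 U) ∧ ∃ U, SymmAt Ψ 2 3 U) := by
  have h1 := keepsSides_of_comp hΦ hΨ hΨ0 (keepsSides_of_symmAt hW hW')
  have h2 := keepsSides_of_comp hΨ hΧ hΧ0 (keepsSides_of_symmAt hZ hZ')
  have hΦ1 := map_one_ne_zero_of_single hΦ0
  have hΨ1 := map_one_ne_zero_of_single hΨ0
  have ha := exists_symmAt_of_comp hΦ hΨ (by decide) h1.sum_zero_one h2.sum_zero_one hΦ1 hΨ1 hW
  have hb := exists_symmAt_of_comp hΦ hΨ (by decide) h1.sum_two_three h2.sum_two_three hΦ1 hΨ1 hW'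
  exact ⟨⟨ha.1, hb.1⟩, ha.2, hb.2⟩

theorem StarIso.isRegular {S T : System} (hS : S.IsRigid) (hT : T.IsRigid)
    (h : S.IsOdd ∨ Nontrivial (S.H1lim hS)) (I : StarIso S T) : I.IsRegular := by
  choose Φ hΦ using fun k => (I.toMap_emb k).2
  choose Ψ hΨ using fun k => (I.invMap_emb k).2
  replace hΦ : ∀ k, Extends (Φ k) (I.toMap k) := hΦ
  replace hΨ : ∀ k, Extends (Ψ k) (I.invMap k) := hΨ
  have hΦ0 := fun k => (hΦ k).map_single_ne_zero (I.toMap_emb k).1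
  have hΨ0 := fun k => (hΨ k).map_single_ne_zero (I.invMap_emb k).1
  have hST := fun k => S.exists_symmAt_trans hS (I.n_strictMono (Nat.lt_succ_self k)).le
  have hTS := fun k => T.exists_symmAt_trans hT (I.m_strictMono (Nat.lt_succ_self k)).le
  have hST' : ∀ k, ∃ U V, SymmAt ((Ψ k).comp (Φ k)) 0 1 U ∧ SymmAt ((Ψ k).comp (Φ k)) 2 3 V ∧
      U * V = V * U ∧ (∃ c : ℤ, (c : ℂ) = ((Ψ k).comp (Φ k) (Matrix.single (Idx.first _ 0)
        (Idx.first _ 0) 1) * (U * V)).trace ∧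
          ∀ x, S.H1trans hS (I.n_strictMono (Nat.lt_succ_self k)).le x = c • x) ∧
      (Even (multiplicity ((I.invMap k).comp (I.toMap k))) →
        ∃ i, I.n k ≤ i ∧ Even (multiplicity (S.map i))) := by
    intro k
    obtain ⟨Ω, hΩ, U, V, hh⟩ := hST k
    rw [← I.inv_comp_to] at hΩ
    -- Extensions to the full matrix algebras are unique, so the symmetries of the transition map
    -- are symmetries of the composed crossover maps.
    obtain rfl := hΩ.unique ((hΦ k).comp (hΨ k))
    rw [← I.inv_comp_to] at hh
    exact ⟨U, V, hh⟩
  have hTS' : ∀ k, ∃ U V, SymmAt ((Φ (k + 1)).comp (Ψ k)) 0 1 U ∧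
      SymmAt ((Φ (k + 1)).comp (Ψ k)) 2 3 V ∧ U * V = V * U := by
    intro k
    obtain ⟨Ω, hΩ, U, V, hU, hV, hUV, -⟩ := hTS k
    rw [← I.to_comp_inv] at hΩ
    obtain rfl := hΩ.unique ((hΨ k).comp (hΦ (k + 1)))
    exact ⟨U, V, hU, hV, hUV⟩
  choose W W' hW hW' hWW hWc hWe using hST'
  choose Z Z' hZ hZ' hZZ using hTS'
  have hex := fun k => exists_symmAt_of_comp_comp (hΦ k).mapsAlg (hΨ k).mapsAlg (hΦ (k + 1)).mapsAlg (hΦ0 k) (hΨ0 k)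
    (hΦ0 (k + 1)) (hW k) (hW' k) (hZ k) (hZ' k)
  choose U hU using fun k => (hex k).1.1
  choose V hV using fun k => (hex k).1.2
  choose U' hU' using fun k => (hex k).2.1
  choose V' hV' using fun k => (hex k).2.2
  have hΦ1 := fun k => map_one_ne_zero_of_single (hΦ0 k)
  have hΨ1 := fun k => map_one_ne_zero_of_single (hΨ0 k)
  have hWeq : ∀ k, W k = Ψ k (U k) * U' k := fun k => (hW k).unique (by decide) ((hU k).comp (hU' k))
  have hWeq' : ∀ k, W' k = Ψ k (V k) * V' k := fun k => (hW' k).unique (by decide) ((hV k).comp (hV' k))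
  have hd := fun k => commute_or_anticommute (hΦ1 k) (hΨ1 k) (hU k) (hV k) (hU' k) (hV' k)
    (by rw [← hWeq, ← hWeq', hWW])
  have hd' := fun k => commute_or_anticommute (hΨ1 k) (hΦ1 (k + 1)) (hU' k) (hV' k) (hU (k + 1))
    (hV (k + 1)) (by
      rw [← (hZ k).unique (by decide) ((hU' k).comp (hU (k + 1))),
        ← (hZ' k).unique (by decide) ((hV' k).comp (hV (k + 1))), hZZ])
  have hne : ∀ k, U k * V k = V k * U k → U k * V k = -(V k * U k) → False := fun k =>
    (hU k).false_of_commute_of_anticommute (hΦ1 k) (hV k)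
  have hne' : ∀ k, U' k * V' k = V' k * U' k → U' k * V' k = -(V' k * U' k) → False := fun k =>
    (hU' k).false_of_commute_of_anticommute (hΨ1 k) (hV' k)
  by_cases hall : ∀ k, U k * V k = V k * U k
  · intro k
    refine ⟨isRegular_of_commute (hΦ k) (hU k) (hV k) (hall k),
      isRegular_of_commute (hΨ k) (hU' k) (hV' k) ?_⟩
    rcases hd k with h1 | h1
    · exact h1.2
    · exact (hne k (hall k) h1.1).elim
  · exfalso
    push Not at hall
    obtain ⟨k, hk⟩ := hall
    -- The alternative is shared by each pair of consecutive crossover maps, so anticommutation at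
    -- stage k passes to all later ones.
    have hanti : ∀ j, k ≤ j → U j * V j = -(V j * U j) ∧ U' j * V' j = -(V' j * U' j) := by
      intro j hj
      induction j, hj using Nat.le_induction with
      | base => exact (hd k).resolve_left fun h1 => hk h1.1
      | succ j hj ih =>
        refine (hd (j + 1)).resolve_left fun h1 => ?_
        rcases hd' j with h2 | h2
        · exact hne' j h2.1 ih.2
        · exact hne (j + 1) h1.1 h2.2
    rcases h with hodd | hnt
    -- Transitions starting at `I.n j ≥ j > a` have even multiplicity, so some connecting map beyond
    -- any given a is even.
    · refine Set.infinite_of_forall_exists_gt (fun a => ?_) hodd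
      set j := max k (a + 1)
      obtain ⟨i, hi, hie⟩ := hWe j (by
        rw [multiplicity_comp (hΦ j) (hΨ j)]
        exact (even_multiplicity (hΦ j) (hU j) (hV j) (hanti j (le_max_left _ _)).1).mul_right _)
      have hja : a + 1 ≤ j := le_max_right _ _
      exact ⟨i, hie, by have := I.n_strictMono.id_le j; simp only [id] at this; omega⟩
    -- The trace computing the action on H₁ has the factor tr(Φ(e)UV) = 0 at every stage from k on.
    · have := S.subsingleton_H1lim hS I.n_strictMono (k := k) (fun j hj x => by
        obtain ⟨c, hc, hcx⟩ := hWc j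
        rw [hWeq, hWeq', trace_comp (hU' j).mem (hV' j).mem,
          trace_eq_zero_of_anticommute (hU j).mem (hanti j hj).1, zero_mul, Int.cast_eq_zero] at hc
        rw [hcx, hc, zero_smul])
      exact not_nontrivial _ hnt

end FourCycle

theorem theorem4p1 (S T : FourCycle.System) (hS : S.IsGeneric) (hT : T.IsGeneric)
    (h : (S.IsOdd ∧ T.IsOdd) ∨ (Nontrivial (S.H1lim hS.1) ∧ Nontrivial (T.H1lim hT.1)))
    (I : FourCycle.StarIso S T) : I.IsRegular :=
  I.isRegular hS.1 hT.1 (h.imp And.left And.left)
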